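/- Consider the complex cubic system $$\dot x = P = x-a_{20}x^3-a_{11}x^2y-a_{02}xy^2-a_{-13}y^3,\qquad \dot y = Q = -(y-b_{02}y^3-b_{11}xy^2-b_{20}x^2y-b_{3,-1}x^3)$$ with parameter space $\mathbb{C}^8$ and $\mathbb{C}[a,b]=\mathbb{C}[a_{20},a_{11},a_{02},a_{-13},b_{3,-1},b_{20},b_{11},b_{02}]$. There is a formal power series $\Psi(x,y)=xy+(\text{terms of degree}\ge 3)$ with coefficients in $\mathbb{C}[a,b]$ and there are polynomials $g_{11},g_{22},\dots\in\mathbb{C}[a,b]$ (focus quantities) such that $$\Psi_x P+\Psi_y Q = g_{11}(xy)^2+g_{22}(xy)^3+g_{33}(xy)^4+\cdots .$$ For every such choice of $\Psi$ and $g_{kk}$, the center variety $\mathbf{V}(I^{(c)})$, $I^{(c)}=\langle g_{11},g_{22},\dots\rangle$, satisfies $$\mathbf{V}(I^{(c)})=\mathbf{V}(\langle g_{11},\dots,g_{55}\rangle)=\mathbf{V}(J_1)\cup\mathbf{V}(J_2)\cup\mathbf{V}(J_3),$$ where $J_1=\langle a_{11}-b_{11},\ 3a_{20}-b_{20},\ 3b_{02}-a_{02}\rangle$,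 $J_2=\langle a_{11},\ b_{11},\ a_{20}+3b_{20},\ b_{02}+3a_{02},\ a_{-13}b_{3,-1}-4a_{02}b_{20}\rangle$, $J_3=\langle a_{20}^2a_{-13}-b_{3,-1}b_{02}^2,\ a_{20}a_{02}-b_{20}b_{02},\ a_{20}a_{-13}b_{20}-a_{02}b_{3,-1}b_{02},\ a_{11}-b_{11},\ a_{02}^2b_{3,-1}-a_{-13}b_{20}^2\rangle$. The irreducible components of the center variety are exactly $\mathbf{V}(J_1),\mathbf{V}(J_2),\mathbf{V}(J_3)$, and these three varieties are distinct. Moreover: 1. $\mathbf{V}(J_1)$ is the set of parameters for which the system is Hamiltonian, that is, $P=H_y$, $Q=-H_x$ for some $H\in\mathbb{C}[x,y]$. 2. Let $U$ be the set of points of $\mathbf{V}(J_2)\setminus\mathbf{V}(H)$ with $a_{02}b_{3,-1}^2\ne 4b_{20}^3$, where $H=\langle b_{20}b_{3,-1}^2,\ b_{3,-1}^2(a_{02}b_{3,-1}^2+4b_{20}^3)\rangle$. The Zariski closure of $U$ is $\mathbf{V}(J_2)$, and for every parameter in $U$ the system has invariant algebraic curves $l_1=0$ and $l_2=0$, with $l_1,l_2\in\mathbb{C}[x,y]$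 nonconstant of degree at most $4$ and $6$, such that $l_1^3l_2^{-2}$ is a nonconstant first integral (a Darboux integral). 3. $\mathbf{V}(J_3)$ is the symmetry component $\mathbf{V}(I_{sym})$. Here, for $\nu\in\mathbb{N}^8$, $[\nu]=a_{20}^{\nu_1}a_{11}^{\nu_2}a_{02}^{\nu_3}a_{-13}^{\nu_4}b_{3,-1}^{\nu_5}b_{20}^{\nu_6}b_{11}^{\nu_7}b_{02}^{\nu_8}$, $\bar\nu=(\nu_8,\dots,\nu_1)$, and $I_{sym}$ is the ideal of $\mathbb{C}[a,b]$ generated by all $[\nu]-[\bar\nu]$ with $$2\nu_1+\nu_2-\nu_4+3\nu_5+2\nu_6+\nu_7=\nu_2+2\nu_3+3\nu_4-\nu_5+\nu_7+2\nu_8=k\quad\text{for some }k\in\mathbb{N}.$$ -/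

import Mathlib

namespace CubicCenter

noncomputable section

/-- The coordinate ring `ℂ[a, b]` of the parameter space `E(a, b) = ℂ⁸`. The eight coefficients
are listed in the order
`a₂₀, a₁₁, a₀₂, a₋₁₃, b₃₋₁, b₂₀, b₁₁, b₀₂`. -/
abbrev Coeffs : Type := MvPolynomial (Fin 8) ℂ

/-- The parameter space `E(a, b) = ℂ⁸`. -/
abbrev Params : Type := Fin 8 → ℂ

def a20 : Coeffs := MvPolynomial.X 0
def a11 : Coeffs := MvPolynomial.X 1
def a02 : Coeffs := MvPolynomial.X 2
def am13 : Coeffs := MvPolynomial.X 3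
def b3m1 : Coeffs := MvPolynomial.X 4
def b20 : Coeffs := MvPolynomial.X 5
def b11 : Coeffs := MvPolynomial.X 6
def b02 : Coeffs := MvPolynomial.X 7

/-! ### The cubic system -/

/-- The phase variable `x`. -/
def x : MvPolynomial (Fin 2) Coeffs := MvPolynomial.X 0

/-- The phase variable `y`. -/
def y : MvPolynomial (Fin 2) Coeffs := MvPolynomial.X 1

/-- The right-hand side of `ẋ = P(x, y)`, with indeterminate coefficients. -/
def P : MvPolynomial (Fin 2) Coeffs :=
  x - MvPolynomial.C a20 * x ^ 3 - MvPolynomial.C a11 * x ^ 2 * y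
    - MvPolynomial.C a02 * x * y ^ 2 - MvPolynomial.C am13 * y ^ 3

/-- The right-hand side of `ẏ = Q(x, y)`, with indeterminate coefficients. -/
def Q : MvPolynomial (Fin 2) Coeffs :=
  -(y - MvPolynomial.C b02 * y ^ 3 - MvPolynomial.C b11 * x * y ^ 2
    - MvPolynomial.C b20 * x ^ 2 * y - MvPolynomial.C b3m1 * x ^ 3)

/-- `P` for the system with parameter point `c`. -/
def Pat (c : Params) : MvPolynomial (Fin 2) ℂ := MvPolynomial.map (MvPolynomial.eval c) P

/-- `Q` for the system with parameter point `c`. -/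
def Qat (c : Params) : MvPolynomial (Fin 2) ℂ := MvPolynomial.map (MvPolynomial.eval c) Q

/-! ### Focus quantities and the center variety -/

/-- `Ψ` is a formal Lyapunov series of the cubic system with focus quantities
`g 1, g 2, …` (written `g₁₁, g₂₂, …`): it has the form `Ψ = x y + (terms of degree ≥ 3)`, its
coefficients are polynomials in `a, b`, and
`Ψ_x P + Ψ_y Q = g₁₁ (x y)² + g₂₂ (x y)³ + g₃₃ (x y)⁴ + ⋯`.
The value `g 0` is not used. -/
structure IsLyapunovSeries (Ψ : MvPowerSeries (Fin 2) Coeffs) (g : ℕ → Coeffs) : Prop where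
  leading : ∀ n : Fin 2 →₀ ℕ, n 0 + n 1 ≤ 2 →
    MvPowerSeries.coeff n Ψ = if n 0 = 1 ∧ n 1 = 1 then 1 else 0
  derivative : ∀ n : Fin 2 →₀ ℕ,
    MvPowerSeries.coeff n
      (MvPowerSeries.pderiv Coeffs 0 Ψ * (P : MvPowerSeries (Fin 2) Coeffs)
        + MvPowerSeries.pderiv Coeffs 1 Ψ * (Q : MvPowerSeries (Fin 2) Coeffs))
      = if n 0 = n 1 ∧ 2 ≤ n 0 then g (n 0 - 1) else 0

/-- The ideal generated by all focus quantities. -/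
def bautinIdeal (g : ℕ → Coeffs) : Ideal Coeffs :=
  Ideal.span {f | ∃ k : ℕ, 1 ≤ k ∧ f = g k}

/-- The ideal generated by the first `m` focus quantities. -/
def bautinIdealUpTo (g : ℕ → Coeffs) (m : ℕ) : Ideal Coeffs :=
  Ideal.span {f | ∃ k : ℕ, 1 ≤ k ∧ k ≤ m ∧ f = g k}

/-- The variety in `ℂ⁸` of an ideal of `ℂ[a, b]`. -/
def variety (I : Ideal Coeffs) : Set Params := MvPolynomial.zeroLocus ℂ I

/-- The variety of the ideal of focus quantities. -/
def centerVariety (g : ℕ → Coeffs) : Set Params := variety (bautinIdeal g)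

/-! ### Irreducible components of affine varieties -/

/-- An affine subvariety of `ℂ⁸` (a Zariski closed subset). -/
def IsVariety (W : Set Params) : Prop := ∃ I : Ideal Coeffs, W = variety I

/-- A nonempty variety that is not the union of two proper subvarieties. -/
def IsIrreducibleVariety (W : Set Params) : Prop :=
  IsVariety W ∧ W.Nonempty ∧
    ∀ A B : Set Params, IsVariety A → IsVariety B → W = A ∪ B → W = A ∨ W = B

/-- `W` is an irreducible component of `V`: a maximal irreducible subvariety. -/
def IsComponent (W V : Set Params) : Prop :=
  IsIrreducibleVariety W ∧ W ⊆ V ∧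
    ∀ W' : Set Params, IsIrreducibleVariety W' → W ⊆ W' → W' ⊆ V → W' = W

/-- The Zariski closure of a set of parameter points. -/
def zariskiClosure (W : Set Params) : Set Params :=
  variety (MvPolynomial.vanishingIdeal ℂ W)

/-! ### The three ideals -/

def J1 : Ideal Coeffs := Ideal.span {a11 - b11, 3 * a20 - b20, 3 * b02 - a02}

def J2 : Ideal Coeffs :=
  Ideal.span {a11, b11, a20 + 3 * b20, b02 + 3 * a02, am13 * b3m1 - 4 * a02 * b20}

def J3 : Ideal Coeffs :=
  Ideal.span {a20 ^ 2 * am13 - b3m1 * b02 ^ 2, a20 * a02 - b20 * b02,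
    a20 * am13 * b20 - a02 * b3m1 * b02, a11 - b11, a02 ^ 2 * b3m1 - am13 * b20 ^ 2}

/-! ### Hamiltonian systems -/

/-- The system with parameter point `c` is Hamiltonian: `ẋ = H_y`, `ẏ = -H_x`. -/
def IsHamiltonian (c : Params) : Prop :=
  ∃ H : MvPolynomial (Fin 2) ℂ,
    Pat c = MvPolynomial.pderiv 1 H ∧ Qat c = -MvPolynomial.pderiv 0 H

/-! ### Darboux integrability -/

/-- The derivative `F_x P + F_y Q` of `F` along the system with parameter point `c`. -/
def orbital (c : Params) (F : MvPolynomial (Fin 2) ℂ) : MvPolynomial (Fin 2) ℂ :=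
  MvPolynomial.pderiv 0 F * Pat c + MvPolynomial.pderiv 1 F * Qat c

/-- `l = 0` is an invariant algebraic curve of the system with parameter point `c`. -/
def IsInvariantCurve (c : Params) (l : MvPolynomial (Fin 2) ℂ) : Prop :=
  0 < l.totalDegree ∧ ∃ K : MvPolynomial (Fin 2) ℂ, orbital c l = K * l

/-- The rational function `F / G` is a nonconstant first integral of the system with parameter
point `c`; the vanishing of `(F / G)_x P + (F / G)_y Q` is written without denominators. -/
def IsRationalFirstIntegral (c : Params) (F G : MvPolynomial (Fin 2) ℂ) : Prop :=
  G ≠ 0 ∧ (∀ k : ℂ, F ≠ MvPolynomial.C k * G) ∧ orbital c F * G = F * orbital c G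

/-- The ideal whose variety has to be removed from `V(J₂)`. -/
def idealH : Ideal Coeffs :=
  Ideal.span {b20 * b3m1 ^ 2, b3m1 ^ 2 * (a02 * b3m1 ^ 2 + 4 * b20 ^ 3)}

/-- The points of `V(J₂)` outside `V(H)` and outside `a₀₂ b₃₋₁² = 4 b₂₀³`. -/
def darbouxSet : Set Params :=
  {c | c ∈ variety J2 ∧ c ∉ variety idealH ∧
    MvPolynomial.eval c (a02 * b3m1 ^ 2) ≠ MvPolynomial.eval c (4 * b20 ^ 3)}

/-! ### The symmetry component -/

/-- The first row of the matrix of the operator `L` of the cubic system, for the index set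
`S = {(2, 0), (1, 1), (0, 2), (-1, 3)}`; the second row is the first one reversed. -/
def Lrow : Fin 8 → ℤ := ![2, 1, 0, -1, 3, 2, 1, 0]

/-- The monoid of the exponents `ν ∈ ℕ⁸` with `L(ν) = (k, k)` for some `k ∈ ℕ`. -/
def sibirskyMonoid : Set (Fin 8 → ℕ) :=
  {ν | ∃ k : ℕ, ∑ i, Lrow i * (ν i : ℤ) = k ∧ ∑ i, Lrow i.rev * (ν i : ℤ) = k}

/-- The monomial `[ν] = a₂₀^ν₁ a₁₁^ν₂ a₀₂^ν₃ a₋₁₃^ν₄ b₃₋₁^ν₅ b₂₀^ν₆ b₁₁^ν₇ b₀₂^ν₈`. -/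
def mono (ν : Fin 8 → ℕ) : Coeffs := ∏ i, MvPolynomial.X i ^ ν i

/-- The Sibirsky ideal, generated by the `[ν] - [ν̄]`, where `ν̄` is `ν` reversed. -/
def sibirskyIdeal : Ideal Coeffs :=
  Ideal.span {f | ∃ ν ∈ sibirskyMonoid, f = mono ν - mono (fun i => ν i.rev)}

/-- The symmetry component of the center variety. -/
def symmetryComponent : Set Params := variety sibirskyIdeal

end

end CubicCenter

namespace CubicCenter

noncomputable section

open MvPolynomial

/-! ### Points of varieties -/

/-! On the monomial x^i y^j the linear part of the vector field acts by the scalar i - j, and the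
cubic part raises degree by two. The off-diagonal coefficients of Ψ can therefore be solved for
recursively, and the obstructions on the diagonal are the focus quantities.

Necessity of the three cases. At a point where the first five focus quantities vanish, the
coefficient equations of Ψ are linear in its coefficients, and eliminating these leaves polynomial
conditions on the parameters (`IsFlatUpTo.focus_one` to `IsFlatUpTo.focus_five`). The first two give
a₁₁ = b₁₁ and a rank-one matrix a₂₀ = tu, b₂₀ = tv, b₀₂ = ru, a₀₂ = rv. The third then factors as
(3u - v)(u + 3v)(t²a₋₁₃ - r²b₃₋₁) up to a constant. The first factor leads to J₁ and the last to J₃.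
On the middle one, the fourth and fifth supply the remaining equations of J₂
(`IsFlatUpTo.mem_union`).

Sufficiency. A nonconstant formal first integral makes every focus quantity vanish, whatever Ψ was
chosen (`IsLyapunovSeries.mem_centerVariety_of_firstIntegral`). On V(J₁) the Hamiltonian is such an
integral. On a dense part of V(J₃) the system is reversible, and symmetrizing Ψ gives one. On a
dense part of V(J₂) an invariant quartic and an invariant sextic have cofactors in ratio 2 : 3, so
that l₁³/l₂² is an integral, and it is regular at the origin on a smaller dense part. Density
suffices because the center variety is closed.

Each V(Jᵢ) is the image of a polynomial map from an affine space. This yields irreducibility, the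
density arguments, and the comparison of V(J₃) with the Sibirsky ideal. Explicit points show that no
component contains another. -/

theorem mem_variety {I : Ideal Coeffs} {c : Params} :
    c ∈ variety I ↔ ∀ f ∈ I, eval c f = 0 := Iff.rfl

theorem mem_variety_span {S : Set Coeffs} {c : Params} :
    c ∈ variety (Ideal.span S) ↔ ∀ f ∈ S, eval c f = 0 := by
  rw [variety, zeroLocus_span]; rfl

theorem mem_variety_J1 {c : Params} :
    c ∈ variety J1 ↔ c 1 = c 6 ∧ 3 * c 0 = c 5 ∧ 3 * c 7 = c 2 := by
  simp [J1, mem_variety_span, a11, b11, a20, b20, b02, a02, sub_eq_zero]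

theorem mem_variety_J2 {c : Params} :
    c ∈ variety J2 ↔ c 1 = 0 ∧ c 6 = 0 ∧ c 0 + 3 * c 5 = 0 ∧ c 7 + 3 * c 2 = 0 ∧
      c 3 * c 4 = 4 * c 2 * c 5 := by
  simp [J2, mem_variety_span, a11, b11, a20, b20, b02, a02, am13, b3m1, sub_eq_zero]

theorem mem_variety_J3 {c : Params} :
    c ∈ variety J3 ↔ c 0 ^ 2 * c 3 = c 4 * c 7 ^ 2 ∧ c 0 * c 2 = c 5 * c 7 ∧
      c 0 * c 3 * c 5 = c 2 * c 4 * c 7 ∧ c 1 = c 6 ∧ c 2 ^ 2 * c 4 = c 3 * c 5 ^ 2 := by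
  simp [J3, mem_variety_span, a11, b11, a20, b20, b02, a02, am13, b3m1, sub_eq_zero]

theorem mem_centerVariety {g : ℕ → Coeffs} {c : Params} :
    c ∈ centerVariety g ↔ ∀ k, 1 ≤ k → eval c (g k) = 0 := by
  rw [centerVariety, bautinIdeal, mem_variety_span]
  exact ⟨fun h k hk => h _ ⟨k, hk, rfl⟩, fun h f ⟨k, hk, e⟩ => e ▸ h k hk⟩

theorem mem_variety_bautinIdealUpTo {g : ℕ → Coeffs} {m : ℕ} {c : Params} :
    c ∈ variety (bautinIdealUpTo g m) ↔ ∀ k, 1 ≤ k → k ≤ m → eval c (g k) = 0 := by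
  rw [bautinIdealUpTo, mem_variety_span]
  exact ⟨fun h k hk hm => h _ ⟨k, hk, hm, rfl⟩, fun h f ⟨k, hk, hm, e⟩ => e ▸ h k hk hm⟩

/-! ### Polynomial parametrizations -/

section Parametrization

variable {ι : Type*}

/-- The point with parameter value `z` under the polynomial map with components `f`. -/
def paramPoint (f : Fin 8 → MvPolynomial ι ℂ) (z : ι → ℂ) : Params := fun i => eval z (f i)

theorem eval_paramPoint (f : Fin 8 → MvPolynomial ι ℂ) (z : ι → ℂ) (p : Coeffs) :
    eval (paramPoint f z) p = eval z (aeval f p) := by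
  have := comp_aeval_apply f (MvPolynomial.aeval (R := ℂ) z) p
  simp only [MvPolynomial.aeval_eq_eval] at this
  rw [this]
  rfl

/-- A polynomial that vanishes at the points `paramPoint f z` with `h z ≠ 0` vanishes at all
points `paramPoint f z`. -/
theorem eval_paramPoint_eq_zero_of_dense (f : Fin 8 → MvPolynomial ι ℂ) {h : MvPolynomial ι ℂ}
    (hh : h ≠ 0) {p : Coeffs} (H : ∀ z, eval z h ≠ 0 → eval (paramPoint f z) p = 0) (z : ι → ℂ) :
    eval (paramPoint f z) p = 0 := by
  -- The pullback of `p` times `h` vanishes at every point, hence is the zero polynomial; the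
  -- polynomial ring is a domain.
  have h0 : aeval f p * h = 0 := by
    refine MvPolynomial.funext fun z => ?_
    by_cases hz : eval z h = 0
    · simp [hz]
    · rw [map_mul, ← eval_paramPoint, H z hz, zero_mul, map_zero]
  rw [eval_paramPoint, (mul_eq_zero.1 h0).resolve_right hh, map_zero]

theorem range_paramPoint_subset_of_dense (f : Fin 8 → MvPolynomial ι ℂ) {h : MvPolynomial ι ℂ}
    (hh : h ≠ 0) {I : Ideal Coeffs} (H : ∀ z, eval z h ≠ 0 → paramPoint f z ∈ variety I) :
    Set.range (paramPoint f) ⊆ variety I := by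
  rintro _ ⟨z, rfl⟩ p hp
  exact eval_paramPoint_eq_zero_of_dense f hh (fun z hz => H z hz p hp) z

/-- A variety with a polynomial parametrization is irreducible. -/
theorem isIrreducibleVariety_of_param (f : Fin 8 → MvPolynomial ι ℂ) {I : Ideal Coeffs}
    (hI : variety I = Set.range (paramPoint f)) : IsIrreducibleVariety (variety I) := by
  refine ⟨⟨I, rfl⟩, hI ▸ ⟨_, 0, rfl⟩, ?_⟩
  rintro _ _ ⟨A, rfl⟩ ⟨B, rfl⟩ hW
  by_contra! hne
  -- A proper subvariety has an equation with nonzero pullback. Two proper subvarieties covering the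
  -- image would make a product of two nonzero pullbacks vanish identically.
  have key : ∀ J : Ideal Coeffs, variety J ⊆ variety I → variety I ≠ variety J →
      ∃ p ∈ J, aeval f p ≠ 0 := by
    intro J hJ hne
    by_contra! h
    refine hne (Set.Subset.antisymm ?_ hJ)
    rw [hI]
    rintro _ ⟨z, rfl⟩ p hp
    change eval _ p = 0
    rw [eval_paramPoint, h p hp, map_zero]
  obtain ⟨p, hp, hp0⟩ := key A (hW ▸ Set.subset_union_left) hne.1
  obtain ⟨q, hq, hq0⟩ := key B (hW ▸ Set.subset_union_right) hne.2
  refine mul_ne_zero hp0 hq0 (MvPolynomial.funext fun z => ?_)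
  have hz : paramPoint f z ∈ variety A ∪ variety B := hW ▸ hI ▸ ⟨z, rfl⟩
  rw [map_mul, ← eval_paramPoint, ← eval_paramPoint, map_zero]
  rcases hz with hz | hz
  · rw [mem_variety.1 hz p hp, zero_mul]
  · rw [mem_variety.1 hz q hq, mul_zero]

end Parametrization

/-! ### Unions, intersections and irreducible components -/

theorem IsVariety.union {A B : Set Params} (hA : IsVariety A) (hB : IsVariety B) :
    IsVariety (A ∪ B) := by
  obtain ⟨I, rfl⟩ := hA
  obtain ⟨J, rfl⟩ := hB
  refine ⟨I * J, Set.Subset.antisymm (Set.union_subset ?_ ?_) fun c hc => ?_⟩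
  · exact zeroLocus_anti_mono Ideal.mul_le_left
  · exact zeroLocus_anti_mono Ideal.mul_le_right
  · by_contra h
    rw [Set.mem_union, not_or] at h
    simp only [mem_variety, not_forall] at h
    obtain ⟨⟨p, hp, hp0⟩, q, hq, hq0⟩ := h
    have := mem_variety.1 hc _ (Ideal.mul_mem_mul hp hq)
    rw [map_mul, mul_eq_zero] at this
    tauto

theorem IsVariety.inter {A B : Set Params} (hA : IsVariety A) (hB : IsVariety B) :
    IsVariety (A ∩ B) := by
  obtain ⟨I, rfl⟩ := hA
  obtain ⟨J, rfl⟩ := hB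
  refine ⟨I ⊔ J, Set.Subset.antisymm (fun c hc => ?_) (Set.subset_inter ?_ ?_)⟩
  · rw [mem_variety]
    intro f hf
    obtain ⟨p, hp, q, hq, rfl⟩ := Submodule.mem_sup.1 hf
    rw [map_add, mem_variety.1 hc.1 p hp, mem_variety.1 hc.2 q hq, add_zero]
  · exact zeroLocus_anti_mono le_sup_left
  · exact zeroLocus_anti_mono le_sup_right

theorem IsIrreducibleVariety.subset_or_subset {W A B : Set Params} (hW : IsIrreducibleVariety W)
    (hA : IsVariety A) (hB : IsVariety B) (h : W ⊆ A ∪ B) : W ⊆ A ∨ W ⊆ B := by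
  have := hW.2.2 (W ∩ A) (W ∩ B) (hW.1.inter hA) (hW.1.inter hB)
    (by rw [← Set.inter_union_distrib_left, Set.inter_eq_left.2 h])
  rcases this with h | h
  · exact Or.inl (Set.inter_eq_left.1 h.symm)
  · exact Or.inr (Set.inter_eq_left.1 h.symm)

/-- The components of an irredundant union of three irreducible varieties. -/
theorem setOf_isComponent_union {A B C : Set Params} (hA : IsIrreducibleVariety A)
    (hB : IsIrreducibleVariety B) (hC : IsIrreducibleVariety C)
    (hAB : ¬ A ⊆ B) (hAC : ¬ A ⊆ C) (hBA : ¬ B ⊆ A) (hBC : ¬ B ⊆ C)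
    (hCA : ¬ C ⊆ A) (hCB : ¬ C ⊆ B) :
    {W | IsComponent W (A ∪ B ∪ C)} = {A, B, C} := by
  have split : ∀ W, IsIrreducibleVariety W → W ⊆ A ∪ B ∪ C → W ⊆ A ∨ W ⊆ B ∨ W ⊆ C := by
    intro W hW h
    rcases hW.subset_or_subset (hA.1.union hB.1) hC.1 h with h | h
    · rcases hW.subset_or_subset hA.1 hB.1 h with h | h <;> tauto
    · tauto
  have hA' : A ⊆ A ∪ B ∪ C := fun _ h => Or.inl (Or.inl h)
  have hB' : B ⊆ A ∪ B ∪ C := fun _ h => Or.inl (Or.inr h)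
  have hC' : C ⊆ A ∪ B ∪ C := fun _ h => Or.inr h
  ext W
  simp only [Set.mem_ofPred_eq, Set.mem_insert_iff, Set.mem_singleton_iff]
  constructor
  · rintro ⟨hW, hs, hmax⟩
    rcases split W hW hs with h | h | h
    · exact Or.inl (hmax A hA h hA').symm
    · exact Or.inr (Or.inl (hmax B hB h hB').symm)
    · exact Or.inr (Or.inr (hmax C hC h hC').symm)
  · rintro (rfl | rfl | rfl)
    · refine ⟨hA, hA', fun W' hW' hs hs' => ?_⟩
      rcases split W' hW' hs' with h | h | h
      · exact h.antisymm hs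
      · exact absurd (hs.trans h) hAB
      · exact absurd (hs.trans h) hAC
    · refine ⟨hB, hB', fun W' hW' hs hs' => ?_⟩
      rcases split W' hW' hs' with h | h | h
      · exact absurd (hs.trans h) hBA
      · exact h.antisymm hs
      · exact absurd (hs.trans h) hBC
    · refine ⟨hC, hC', fun W' hW' hs hs' => ?_⟩
      rcases split W' hW' hs' with h | h | h
      · exact absurd (hs.trans h) hCA
      · exact absurd (hs.trans h) hCB
      · exact h.antisymm hs

/-! ### The three components -/

def param1 : Fin 8 → MvPolynomial (Fin 5) ℂ :=
  ![X 1, X 0, 3 * X 2, X 3, X 4, 3 * X 1, X 0, X 2]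

def param2 : Fin 8 → MvPolynomial (Fin 4) ℂ :=
  ![-3 * (X 1 * X 3), 0, X 0 * X 2, 2 * (X 0 * X 1), 2 * (X 2 * X 3), X 1 * X 3, 0,
    -3 * (X 0 * X 2)]

def param3 : Fin 8 → MvPolynomial (Fin 6) ℂ :=
  ![X 1 * X 3, X 0, X 2 * X 4, X 2 ^ 2 * X 5, X 1 ^ 2 * X 5, X 1 * X 4, X 0, X 2 * X 3]

theorem paramPoint_param1 (z : Fin 5 → ℂ) :
    paramPoint param1 z = ![z 1, z 0, 3 * z 2, z 3, z 4, 3 * z 1, z 0, z 2] := by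
  funext i; fin_cases i <;> simp [paramPoint, param1]

theorem paramPoint_param2 (z : Fin 4 → ℂ) :
    paramPoint param2 z = ![-3 * (z 1 * z 3), 0, z 0 * z 2, 2 * (z 0 * z 1), 2 * (z 2 * z 3),
      z 1 * z 3, 0, -3 * (z 0 * z 2)] := by
  funext i; fin_cases i <;> simp [paramPoint, param2]

theorem paramPoint_param3 (z : Fin 6 → ℂ) :
    paramPoint param3 z = ![z 1 * z 3, z 0, z 2 * z 4, z 2 ^ 2 * z 5, z 1 ^ 2 * z 5, z 1 * z 4,
      z 0, z 2 * z 3] := by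
  funext i; fin_cases i <;> simp [paramPoint, param3]

/-- A vanishing 2 × 2 determinant is a matrix of rank at most one. -/
theorem exists_factors_of_mul_eq_mul {a b c d : ℂ} (h : a * d = b * c) :
    ∃ t r u v : ℂ, a = t * u ∧ b = t * v ∧ c = r * u ∧ d = r * v := by
  by_cases ha : a = 0
  · by_cases hb : b = 0
    · exact ⟨0, 1, c, d, by simp [ha], by simp [hb], by simp, by simp⟩
    · refine ⟨1, d / b, 0, b, by simp [ha], by simp, ?_, by field_simp⟩
      rw [ha, zero_mul, eq_comm, mul_eq_zero] at h
      simp [h.resolve_left hb]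
  · refine ⟨1, c / a, a, b, by simp, by simp, by field_simp, ?_⟩
    field_simp
    linear_combination h

theorem exists_sq_factors {t r p q : ℂ} (h : t ^ 2 * p = r ^ 2 * q) (h0 : t ≠ 0 ∨ r ≠ 0) :
    ∃ w, p = r ^ 2 * w ∧ q = t ^ 2 * w := by
  by_cases ht : t = 0
  · have hr : r ≠ 0 := h0.resolve_left (not_not.2 ht)
    refine ⟨p / r ^ 2, by field_simp, ?_⟩
    have : q = 0 := by simpa [ht, hr] using h.symm
    simp [this, ht]
  · refine ⟨q / t ^ 2, ?_, by field_simp⟩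
    field_simp
    linear_combination h

theorem exists_sq_mul_eq (p q : ℂ) : ∃ t r w : ℂ, p = r ^ 2 * w ∧ q = t ^ 2 * w := by
  obtain ⟨r, hr⟩ := IsAlgClosed.exists_pow_nat_eq p (n := 2) two_pos
  obtain ⟨t, ht⟩ := IsAlgClosed.exists_pow_nat_eq q (n := 2) two_pos
  exact ⟨t, r, 1, by simp [hr], by simp [ht]⟩

theorem variety_J1_eq_range : variety J1 = Set.range (paramPoint param1) := by
  ext c
  simp only [Set.mem_range, paramPoint_param1, mem_variety_J1]
  constructor
  · rintro ⟨h1, h2, h3⟩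
    refine ⟨![c 1, c 0, c 7, c 3, c 4], ?_⟩
    funext i; fin_cases i <;> simp [h1, h2, h3]
  · rintro ⟨z, rfl⟩
    simp

theorem variety_J2_eq_range : variety J2 = Set.range (paramPoint param2) := by
  ext c
  simp only [Set.mem_range, paramPoint_param2, mem_variety_J2]
  constructor
  · rintro ⟨h1, h2, h3, h4, h5⟩
    -- The halves split the factor 4 evenly, so that the last generator of `J2` becomes a vanishing
    -- 2 × 2 determinant.
    obtain ⟨a, d, b, e, h6, h7, h8, h9⟩ := exists_factors_of_mul_eq_mul
      (a := c 3 / 2) (b := c 2) (c := c 5) (d := c 4 / 2) (by linear_combination h5 / 4)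
    refine ⟨![a, b, e, d], ?_⟩
    funext i; fin_cases i <;> simp
    · linear_combination -h3 + 3 * h8
    · exact h1.symm
    · exact h7.symm
    · linear_combination -2 * h6
    · linear_combination -2 * h9
    · linear_combination -h8
    · exact h2.symm
    · linear_combination -h4 + 3 * h7
  · rintro ⟨z, rfl⟩
    simp
    ring

theorem variety_J3_eq_range : variety J3 = Set.range (paramPoint param3) := by
  ext c
  simp only [Set.mem_range, paramPoint_param3, mem_variety_J3]
  constructor
  · rintro ⟨h1, h2, h3, h4, h5⟩
    obtain ⟨t, r, u, v, e0, e5, e7, e2⟩ := exists_factors_of_mul_eq_mul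
      (a := c 0) (b := c 5) (c := c 7) (d := c 2) h2
    have fin : ∀ t r u v w : ℂ, c 0 = t * u → c 5 = t * v → c 7 = r * u → c 2 = r * v →
        c 3 = r ^ 2 * w → c 4 = t ^ 2 * w → ∃ z : Fin 6 → ℂ, ![z 1 * z 3, z 0, z 2 * z 4,
          z 2 ^ 2 * z 5, z 1 ^ 2 * z 5, z 1 * z 4, z 0, z 2 * z 3] = c := by
      intro t r u v w e0' e5' e7' e2' e3 e4
      refine ⟨![c 1, t, r, u, v, w], ?_⟩
      funext i; fin_cases i <;> simp [e0', e5', e7', e2', e3, e4, h4]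
    -- Here the whole rank-one matrix is zero, so its row factor may be replaced by square roots of
    -- c 4 and c 3, with zero column factor.
    by_cases h0 : (t = 0 ∧ r = 0) ∨ (u = 0 ∧ v = 0)
    · obtain ⟨t', r', w, e3, e4⟩ := exists_sq_mul_eq (c 3) (c 4)
      refine fin t' r' 0 0 w ?_ ?_ ?_ ?_ e3 e4 <;> rcases h0 with h | h <;> simp [*]
    · rw [not_or, not_and_or, not_and_or] at h0
      -- The first and last relations of `J3` are this equation multiplied by u² and by v², and one
      -- of u, v is nonzero.
      have hK : t ^ 2 * c 3 = r ^ 2 * c 4 := by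
        rw [e0, e7] at h1
        rw [e2, e5] at h5
        rcases h0.2 with hu | hv
        · exact mul_left_cancel₀ (pow_ne_zero 2 hu) (by linear_combination h1)
        · exact mul_left_cancel₀ (pow_ne_zero 2 hv) (by linear_combination -h5)
      obtain ⟨w, e3, e4⟩ := exists_sq_factors hK h0.1
      exact fin t r u v w e0 e5 e7 e2 e3 e4
  · rintro ⟨z, rfl⟩
    simp
    refine ⟨?_, ?_, ?_, ?_⟩ <;> ring

theorem isIrreducibleVariety_J1 : IsIrreducibleVariety (variety J1) :=
  isIrreducibleVariety_of_param _ variety_J1_eq_range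

theorem isIrreducibleVariety_J2 : IsIrreducibleVariety (variety J2) :=
  isIrreducibleVariety_of_param _ variety_J2_eq_range

theorem isIrreducibleVariety_J3 : IsIrreducibleVariety (variety J3) :=
  isIrreducibleVariety_of_param _ variety_J3_eq_range

/-! ### Points showing that the three varieties are pairwise not nested -/

theorem not_J1_subset_J2 : ¬ variety J1 ⊆ variety J2 := fun h => by
  have h1 : ![0, 1, 0, 0, 0, 0, 1, 0] ∈ variety J1 := mem_variety_J1.2 (by simp)
  simpa using (mem_variety_J2.1 (h h1)).1

theorem not_J3_subset_J2 : ¬ variety J3 ⊆ variety J2 := fun h => by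
  have h1 : ![0, 1, 0, 0, 0, 0, 1, 0] ∈ variety J3 := mem_variety_J3.2 (by simp)
  simpa using (mem_variety_J2.1 (h h1)).1

theorem not_J1_subset_J3 : ¬ variety J1 ⊆ variety J3 := fun h => by
  have h1 : ![1, 0, 0, 1, 0, 3, 0, 0] ∈ variety J1 := mem_variety_J1.2 (by simp)
  simpa using (mem_variety_J3.1 (h h1)).1

theorem not_J2_subset_J3 : ¬ variety J2 ⊆ variety J3 := fun h => by
  have h1 : ![-3, 0, 0, 1, 0, 1, 0, 0] ∈ variety J2 := mem_variety_J2.2 (by simp)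
  simpa using (mem_variety_J3.1 (h h1)).1

theorem not_J2_subset_J1 : ¬ variety J2 ⊆ variety J1 := fun h => by
  have h1 : ![-3, 0, 0, 1, 0, 1, 0, 0] ∈ variety J2 := mem_variety_J2.2 (by simp)
  have h2 : 3 * (-3 : ℂ) = 1 := (mem_variety_J1.1 (h h1)).2.1
  norm_num at h2

theorem not_J3_subset_J1 : ¬ variety J3 ⊆ variety J1 := fun h => by
  have h1 : ![1, 0, 0, 0, 0, 0, 0, 0] ∈ variety J3 := mem_variety_J3.2 (by simp)
  simpa using (mem_variety_J1.1 (h h1)).2.1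

/-! ### The symmetry component -/

theorem eval_mono (c : Params) (ν : Fin 8 → ℕ) : eval c (mono ν) = ∏ i, c i ^ ν i := by
  simp [mono]

/-- Under `param3` the exponents of z 0, z 3, z 4 and z 5 in [ν] do not change when ν is reversed,
while those of z 1 and z 2 are exchanged. Equality of the two components of L(ν) says exactly that
these two exponents agree. Conversely, the generators of `J3` are themselves binomials [ν] - [ν̄].
-/
theorem variety_J3_eq_symmetryComponent : variety J3 = symmetryComponent := by
  refine Set.Subset.antisymm ?_ fun c hc => ?_
  · rw [variety_J3_eq_range]
    rintro _ ⟨z, rfl⟩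
    rw [symmetryComponent, sibirskyIdeal, mem_variety_span]
    rintro _ ⟨ν, ⟨k, h1, h2⟩, rfl⟩
    rw [map_sub, eval_mono, eval_mono, paramPoint_param3]
    simp only [Fin.sum_univ_eight, Lrow, Fin.prod_univ_eight] at h1 h2 ⊢
    simp [Fin.rev] at h1 h2 ⊢
    -- Half the difference of the two rows of L.
    have hL : ν 0 + 2 * ν 4 + ν 5 = ν 7 + 2 * ν 3 + ν 2 := by omega
    have hL' : z 1 ^ (ν 0 + 2 * ν 4 + ν 5) = z 1 ^ (ν 7 + 2 * ν 3 + ν 2) := by rw [hL]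
    have hL'' : z 2 ^ (ν 0 + 2 * ν 4 + ν 5) = z 2 ^ (ν 7 + 2 * ν 3 + ν 2) := by rw [hL]
    simp only [pow_add, pow_mul] at hL' hL''
    simp only [mul_pow]
    linear_combination z 3 ^ (ν 0 + ν 7) * z 4 ^ (ν 2 + ν 5) * z 0 ^ (ν 1 + ν 6) *
      z 5 ^ (ν 3 + ν 4) * (z 2 ^ (ν 2 + 2 * ν 3 + ν 7) * hL' - z 1 ^ (ν 2 + 2 * ν 3 + ν 7) * hL'')
  · have key : ∀ ν ∈ sibirskyMonoid, ∏ i, c i ^ ν i = ∏ i, c i ^ ν i.rev := by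
      intro ν hν
      have := mem_variety_span.1 hc _ ⟨ν, hν, rfl⟩
      rwa [map_sub, eval_mono, eval_mono, sub_eq_zero] at this
    have mem : ∀ ν : Fin 8 → ℕ, (∃ k : ℕ, ∑ i, Lrow i * (ν i : ℤ) = k ∧
      ∑ i, Lrow i.rev * (ν i : ℤ) = k) → ν ∈ sibirskyMonoid := fun _ h => h
    -- These five exponents give the generators of `J3` in order, up to sign.
    have k1 := key ![2, 0, 0, 1, 0, 0, 0, 0] (mem _ ⟨3, by decide, by decide⟩)
    have k2 := key ![1, 0, 1, 0, 0, 0, 0, 0] (mem _ ⟨2, by decide, by decide⟩)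
    have k3 := key ![1, 0, 0, 1, 0, 1, 0, 0] (mem _ ⟨3, by decide, by decide⟩)
    have k4 := key ![0, 1, 0, 0, 0, 0, 0, 0] (mem _ ⟨1, by decide, by decide⟩)
    have k5 := key ![0, 0, 2, 0, 1, 0, 0, 0] (mem _ ⟨3, by decide, by decide⟩)
    simp only [Fin.prod_univ_eight] at k1 k2 k3 k4 k5
    simp [Fin.rev] at k1 k2 k3 k4 k5
    exact mem_variety_J3.2 ⟨k1, k2, by linear_combination k3, k4, k5⟩

end

end CubicCenter

namespace CubicCenter

noncomputable section

/-! ### Coefficients of power series in two variables -/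

section Coefficients

open MvPowerSeries

variable {R : Type*} [CommRing R]

/-- The exponent of `x ^ i * y ^ j`. -/
def expo (i j : ℕ) : Fin 2 →₀ ℕ := Finsupp.single 0 i + Finsupp.single 1 j

@[simp] theorem expo_zero (i j : ℕ) : expo i j 0 = i := by simp [expo]

@[simp] theorem expo_one (i j : ℕ) : expo i j 1 = j := by simp [expo]

theorem expo_eta (n : Fin 2 →₀ ℕ) : expo (n 0) (n 1) = n := by
  ext k; fin_cases k <;> simp

/-- The coefficient of `x ^ i * y ^ j`, which is zero when `i` or `j` is negative. -/
def coef (F : MvPowerSeries (Fin 2) R) (i j : ℤ) : R :=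
  if 0 ≤ i ∧ 0 ≤ j then coeff (expo i.toNat j.toNat) F else 0

@[simp] theorem coef_natCast (F : MvPowerSeries (Fin 2) R) (i j : ℕ) :
    coef F i j = coeff (expo i j) F := by simp [coef]

theorem coef_of_neg {F : MvPowerSeries (Fin 2) R} {i j : ℤ} (h : i < 0 ∨ j < 0) :
    coef F i j = 0 := if_neg (by omega)

theorem coeff_eq_coef (F : MvPowerSeries (Fin 2) R) (n : Fin 2 →₀ ℕ) :
    coeff n F = coef F (n 0) (n 1) := by rw [coef_natCast, expo_eta]

theorem ext_coef {F G : MvPowerSeries (Fin 2) R} (h : ∀ i j, coef F i j = coef G i j) : F = G := by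
  ext n
  rw [coeff_eq_coef, coeff_eq_coef, h]

/-- The power series with given coefficients. -/
def ofCoef (f : ℤ → ℤ → R) : MvPowerSeries (Fin 2) R := fun n => f (n 0) (n 1)

theorem coef_ofCoef {f : ℤ → ℤ → R} (hf : ∀ i j, i < 0 ∨ j < 0 → f i j = 0) (i j : ℤ) :
    coef (ofCoef f) i j = f i j := by
  by_cases h : 0 ≤ i ∧ 0 ≤ j
  · lift i to ℕ using h.1
    lift j to ℕ using h.2
    rw [coef_natCast]
    change f (expo i j 0 : ℕ) (expo i j 1 : ℕ) = _
    simp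
  · rw [coef_of_neg (by omega), hf _ _ (by omega)]

theorem coef_add (F G : MvPowerSeries (Fin 2) R) (i j : ℤ) :
    coef (F + G) i j = coef F i j + coef G i j := by
  unfold coef; split_ifs <;> simp

theorem coef_sub (F G : MvPowerSeries (Fin 2) R) (i j : ℤ) :
    coef (F - G) i j = coef F i j - coef G i j := by
  unfold coef; split_ifs <;> simp

theorem coef_neg (F : MvPowerSeries (Fin 2) R) (i j : ℤ) : coef (-F) i j = -coef F i j := by
  unfold coef; split_ifs <;> simp

theorem coef_C_mul (r : R) (F : MvPowerSeries (Fin 2) R) (i j : ℤ) :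
    coef (C r * F) i j = r * coef F i j := by
  unfold coef; split_ifs <;> simp

theorem coef_X_zero_mul (F : MvPowerSeries (Fin 2) R) (i j : ℤ) :
    coef (X 0 * F) i j = coef F (i - 1) j := by
  by_cases h : 0 ≤ i ∧ 0 ≤ j
  · lift i to ℕ using h.1
    lift j to ℕ using h.2
    rw [coef_natCast, X, coeff_monomial_mul]
    rcases i with _ | i
    · rw [if_neg, coef_of_neg (by simp)]
      intro h
      simpa using h 0
    · have e : expo (i + 1) j = Finsupp.single 0 1 + expo i j := by
        ext k; fin_cases k <;> simp [expo, add_comm]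
      rw [if_pos (e ▸ le_self_add), e, add_tsub_cancel_left, one_mul, ← coef_natCast]
      simp
  · rw [coef_of_neg (by omega), coef_of_neg (by omega)]

theorem coef_X_one_mul (F : MvPowerSeries (Fin 2) R) (i j : ℤ) :
    coef (X 1 * F) i j = coef F i (j - 1) := by
  by_cases h : 0 ≤ i ∧ 0 ≤ j
  · lift i to ℕ using h.1
    lift j to ℕ using h.2
    rw [coef_natCast, X, coeff_monomial_mul]
    rcases j with _ | j
    · rw [if_neg, coef_of_neg (by simp)]
      intro h
      simpa using h 1
    · have e : expo i (j + 1) = Finsupp.single 1 1 + expo i j := by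
        ext k; fin_cases k <;> simp [expo, add_comm]
      rw [if_pos (e ▸ le_self_add), e, add_tsub_cancel_left, one_mul, ← coef_natCast]
      simp
  · rw [coef_of_neg (by omega), coef_of_neg (by omega)]

theorem coef_pderiv_zero (F : MvPowerSeries (Fin 2) R) (i j : ℤ) :
    coef (pderiv R 0 F) i j = (i + 1 : ℤ) * coef F (i + 1) j := by
  by_cases h : 0 ≤ i ∧ 0 ≤ j
  · lift i to ℕ using h.1
    lift j to ℕ using h.2
    have e : expo i j + Finsupp.single 0 1 = expo (i + 1) j := by
      ext k; fin_cases k <;> simp [expo, add_comm]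
    rw [coef_natCast, coeff_pderiv, e, ← coef_natCast]
    simp [mul_comm]
  · rw [coef_of_neg (by omega)]
    by_cases h' : i = -1
    · simp [h']
    · rw [coef_of_neg (by omega), mul_zero]

theorem coef_pderiv_one (F : MvPowerSeries (Fin 2) R) (i j : ℤ) :
    coef (pderiv R 1 F) i j = (j + 1 : ℤ) * coef F i (j + 1) := by
  by_cases h : 0 ≤ i ∧ 0 ≤ j
  · lift i to ℕ using h.1
    lift j to ℕ using h.2
    have e : expo i j + Finsupp.single 1 1 = expo i (j + 1) := by
      ext k; fin_cases k <;> simp [expo, add_comm]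
    rw [coef_natCast, coeff_pderiv, e, ← coef_natCast]
    simp [mul_comm]
  · rw [coef_of_neg (by omega)]
    by_cases h' : j = -1
    · simp [h']
    · rw [coef_of_neg (by omega), mul_zero]

theorem coef_map {S : Type*} [CommRing S] (φ : R →+* S) (F : MvPowerSeries (Fin 2) R) (i j : ℤ) :
    coef (map φ F) i j = φ (coef F i j) := by
  unfold coef; split_ifs <;> simp

end Coefficients

/-! ### The derivation defined by the cubic system -/

section Derivation

variable {R : Type*} [CommRing R]

/-- The right-hand side of `ẋ = P(x, y)` with coefficients `c` in a ring. -/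
def cubicP (c : Fin 8 → R) : MvPolynomial (Fin 2) R :=
  MvPolynomial.X 0 - MvPolynomial.C (c 0) * MvPolynomial.X 0 ^ 3
    - MvPolynomial.C (c 1) * MvPolynomial.X 0 ^ 2 * MvPolynomial.X 1
    - MvPolynomial.C (c 2) * MvPolynomial.X 0 * MvPolynomial.X 1 ^ 2
    - MvPolynomial.C (c 3) * MvPolynomial.X 1 ^ 3

/-- The right-hand side of `ẏ = Q(x, y)` with coefficients `c` in a ring. -/
def cubicQ (c : Fin 8 → R) : MvPolynomial (Fin 2) R :=
  -(MvPolynomial.X 1 - MvPolynomial.C (c 7) * MvPolynomial.X 1 ^ 3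
    - MvPolynomial.C (c 6) * MvPolynomial.X 0 * MvPolynomial.X 1 ^ 2
    - MvPolynomial.C (c 5) * MvPolynomial.X 0 ^ 2 * MvPolynomial.X 1
    - MvPolynomial.C (c 4) * MvPolynomial.X 0 ^ 3)

theorem cubicP_X : cubicP MvPolynomial.X = P := rfl

theorem cubicQ_X : cubicQ MvPolynomial.X = Q := rfl

theorem Pat_eq (c : Params) : Pat c = cubicP c := by
  simp [Pat, P, cubicP, a20, a11, a02, am13, x, y]

theorem Qat_eq (c : Params) : Qat c = cubicQ c := by
  simp [Qat, Q, cubicQ, b20, b11, b02, b3m1, x, y]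

/-- The derivation `P ∂/∂x + Q ∂/∂y` of the ring of power series. -/
def lieD (c : Fin 8 → R) : Derivation R (MvPowerSeries (Fin 2) R) (MvPowerSeries (Fin 2) R) :=
  (cubicP c : MvPowerSeries (Fin 2) R) • MvPowerSeries.pderiv R 0
    + (cubicQ c : MvPowerSeries (Fin 2) R) • MvPowerSeries.pderiv R 1

theorem lieD_apply (c : Fin 8 → R) (F : MvPowerSeries (Fin 2) R) :
    lieD c F = MvPowerSeries.pderiv R 0 F * (cubicP c : MvPowerSeries (Fin 2) R)
      + MvPowerSeries.pderiv R 1 F * (cubicQ c : MvPowerSeries (Fin 2) R) := by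
  simp [lieD, mul_comm]

/-- The part of `-lieD c F` that comes from the cubic terms of the system, on coefficients. -/
def cubicPart (c : Fin 8 → R) (f : ℤ → ℤ → R) (i j : ℤ) : R :=
  (c 0 * (i - 2 : ℤ) - c 5 * j) * f (i - 2) j
    + (c 1 * (i - 1 : ℤ) - c 6 * (j - 1 : ℤ)) * f (i - 1) (j - 1)
    + (c 2 * i - c 7 * (j - 2 : ℤ)) * f i (j - 2)
    + c 3 * (i + 1 : ℤ) * f (i + 1) (j - 3) - c 4 * (j + 1 : ℤ) * f (i - 3) (j + 1)

/-- The linear part x ∂/∂x - y ∂/∂y is diagonal on monomials. Coefficients with a negative index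
being zero, the same formula holds for all integer indices, with no boundary cases. -/
theorem coef_lieD (c : Fin 8 → R) (F : MvPowerSeries (Fin 2) R) (i j : ℤ) :
    coef (lieD c F) i j = (i - j : ℤ) * coef F i j - cubicPart c (coef F) i j := by
  open MvPowerSeries in
  have e : lieD c F = X 0 * pderiv R 0 F - C (c 0) * (X 0 * (X 0 * (X 0 * pderiv R 0 F)))
      - C (c 1) * (X 0 * (X 0 * (X 1 * pderiv R 0 F)))
      - C (c 2) * (X 0 * (X 1 * (X 1 * pderiv R 0 F)))
      - C (c 3) * (X 1 * (X 1 * (X 1 * pderiv R 0 F)))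
      - X 1 * pderiv R 1 F + C (c 7) * (X 1 * (X 1 * (X 1 * pderiv R 1 F)))
      + C (c 6) * (X 0 * (X 1 * (X 1 * pderiv R 1 F)))
      + C (c 5) * (X 0 * (X 0 * (X 1 * pderiv R 1 F)))
      + C (c 4) * (X 0 * (X 0 * (X 0 * pderiv R 1 F))) := by
    rw [lieD_apply, cubicP, cubicQ]
    simp only [← MvPolynomial.coeToMvPowerSeries.ringHom_apply, map_sub, map_neg, map_mul, map_pow]
    simp only [MvPolynomial.coeToMvPowerSeries.ringHom_apply, MvPolynomial.coe_X,
      MvPolynomial.coe_C]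
    ring
  simp only [e, coef_add, coef_sub, coef_C_mul, coef_X_zero_mul, coef_X_one_mul,
    coef_pderiv_zero, coef_pderiv_one, cubicPart]
  ring_nf
  push_cast
  ring

theorem coef_lieD_map {S : Type*} [CommRing S] (φ : R →+* S) (c : Fin 8 → R)
    (F : MvPowerSeries (Fin 2) R) (i j : ℤ) :
    coef (lieD (fun k => φ (c k)) (MvPowerSeries.map φ F)) i j = φ (coef (lieD c F) i j) := by
  simp only [coef_lieD, cubicPart, coef_map, map_add, map_sub, map_mul, map_intCast]

theorem isLyapunovSeries_iff {Ψ : MvPowerSeries (Fin 2) Coeffs} {g : ℕ → Coeffs} :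
    IsLyapunovSeries Ψ g ↔
      (∀ i j : ℤ, i + j ≤ 2 → coef Ψ i j = if i = 1 ∧ j = 1 then 1 else 0) ∧
      ∀ i j : ℤ, coef (lieD MvPolynomial.X Ψ) i j =
        if i = j ∧ 2 ≤ i then g (i.toNat - 1) else 0 := by
  constructor
  · rintro ⟨h1, h2⟩
    refine ⟨fun i j h => ?_, fun i j => ?_⟩
    · by_cases h' : 0 ≤ i ∧ 0 ≤ j
      · lift i to ℕ using h'.1
        lift j to ℕ using h'.2
        rw [coef_natCast, h1 _ (by simp; omega)]
        simp
      · rw [coef_of_neg (by omega), if_neg (by omega)]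
    · by_cases h' : 0 ≤ i ∧ 0 ≤ j
      · lift i to ℕ using h'.1
        lift j to ℕ using h'.2
        rw [coef_natCast, lieD_apply, cubicP_X, cubicQ_X, h2]
        simp
      · rw [coef_of_neg (by omega), if_neg (by omega)]
  · rintro ⟨h1, h2⟩
    refine ⟨fun n h => ?_, fun n => ?_⟩
    · rw [coeff_eq_coef, h1 _ _ (by omega)]
      simp
    · rw [← cubicP_X, ← cubicQ_X, ← lieD_apply, coeff_eq_coef, h2]
      simp

end Derivation

/-! ### Existence of focus quantities -/

section Existence

/-- The homogeneous parts of a Lyapunov series, by their coefficients. -/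
def lyapunovPart : ℕ → ℤ → ℤ → Coeffs
  | 0 => 0
  | 1 => 0
  | 2 => fun i j => if i = 1 ∧ j = 1 then 1 else 0
  -- The cubic terms reach degree d + 3 only from degree d + 1. Diagonal coefficients are free and
  -- are set to zero; the others are solved for by dividing by i - j.
  | d + 3 => fun i j => if i < 0 ∨ j < 0 ∨ i = j then 0 else
      MvPolynomial.C ((i - j : ℂ)⁻¹) * cubicPart MvPolynomial.X (lyapunovPart (d + 1)) i j

theorem lyapunovPart_of_neg (d : ℕ) (i j : ℤ) (h : i < 0 ∨ j < 0) : lyapunovPart d i j = 0 := by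
  match d with
  | 0 => rfl
  | 1 => rfl
  | 2 => exact if_neg (by omega)
  | d + 3 => exact if_pos (by omega)

theorem exists_isLyapunovSeries :
    ∃ (Ψ : MvPowerSeries (Fin 2) Coeffs) (g : ℕ → Coeffs), IsLyapunovSeries Ψ g := by
  set f : ℤ → ℤ → Coeffs := fun i j => lyapunovPart (i + j).toNat i j with hf
  have hc : coef (ofCoef f) = f := by
    funext i j
    exact coef_ofCoef (fun i j h => lyapunovPart_of_neg _ i j h) i j
  have small : ∀ i j : ℤ, i + j ≤ 2 → f i j = if i = 1 ∧ j = 1 then 1 else 0 := by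
    intro i j h
    by_cases h' : i < 0 ∨ j < 0
    · rw [if_neg (by omega)]
      exact lyapunovPart_of_neg _ i j h'
    · rcases (by omega : i + j = 0 ∨ i + j = 1 ∨ i + j = 2) with e | e | e
      · rw [if_neg (by omega)]; simp [hf, e, lyapunovPart]
      · rw [if_neg (by omega)]; simp [hf, e, lyapunovPart]
      · simp [hf, e, lyapunovPart]
  have zero : ∀ i j : ℤ, i + j ≤ 1 → f i j = 0 := by
    intro i j h
    rw [small i j (by omega), if_neg (by omega)]
  have part : ∀ i j : ℤ, cubicPart MvPolynomial.X f i j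
      = cubicPart MvPolynomial.X (lyapunovPart (i + j - 2).toNat) i j := by
    intro i j
    simp only [cubicPart, hf]
    ring_nf
  -- Off the diagonal the derivative vanishes by construction, so the focus quantities are simply
  -- read off on the diagonal.
  refine ⟨ofCoef f, fun k => coef (lieD MvPolynomial.X (ofCoef f)) (k + 1) (k + 1),
    isLyapunovSeries_iff.2 ⟨fun i j h => by rw [hc, small i j h], fun i j => ?_⟩⟩
  by_cases hij : i = j ∧ 2 ≤ i
  · obtain ⟨rfl, h⟩ := hij
    have : ((i.toNat - 1 : ℕ) : ℤ) + 1 = i := by omega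
    rw [if_pos ⟨rfl, h⟩, this]
  rw [if_neg hij]
  by_cases hneg : i < 0 ∨ j < 0
  · exact coef_of_neg hneg
  rw [coef_lieD, hc]
  by_cases h : i + j ≤ 2
  · have : cubicPart MvPolynomial.X f i j = 0 := by
      simp only [cubicPart]
      rw [zero (i - 2) j (by omega), zero (i - 1) (j - 1) (by omega), zero i (j - 2) (by omega),
        zero (i + 1) (j - 3) (by omega), zero (i - 3) (j + 1) (by omega)]
      ring
    rw [this, small i j h]
    split_ifs with h'
    · simp [h'.1, h'.2]
    · simp
  · obtain ⟨d, hd⟩ : ∃ d : ℕ, i + j = d + 3 := ⟨(i + j - 3).toNat, by omega⟩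
    have hne : i ≠ j := by omega
    have e1 : (i + j).toNat = d + 3 := by omega
    have e2 : (i + j - 2).toNat = d + 1 := by omega
    have hne' : (i - j : ℂ) ≠ 0 := by
      rw [sub_ne_zero]
      exact_mod_cast hne
    have e3 : f i j = MvPolynomial.C ((i - j : ℂ)⁻¹) *
        cubicPart MvPolynomial.X (lyapunovPart (d + 1)) i j := by
      simp only [hf, e1, lyapunovPart]
      exact if_neg (by omega)
    have e4 : ((i - j : ℤ) : Coeffs) = MvPolynomial.C (i - j : ℂ) := by
      push_cast
      simp
    rw [part, e2, e3, e4, ← mul_assoc, ← map_mul, mul_inv_cancel₀ hne', map_one, one_mul, sub_self]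

end Existence

end

end CubicCenter

namespace CubicCenter

noncomputable section

/-! ### Vanishing of the first focus quantities -/

/-- `f` is the family of coefficients of a power series `x y + ⋯` whose derivative along the
system with parameter point `c` vanishes up to degree `2 N + 2`. -/
structure IsFlatUpTo (c : Params) (f : ℤ → ℤ → ℂ) (N : ℤ) : Prop where
  support : ∀ i j : ℤ, i < 0 ∨ j < 0 → f i j = 0
  lead20 : f 2 0 = 0
  lead11 : f 1 1 = 1
  lead02 : f 0 2 = 0
  flat : ∀ i j : ℤ, i + j ≤ 2 * N + 2 → ((i - j : ℤ) : ℂ) * f i j = cubicPart c f i j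

theorem IsFlatUpTo.mono {c : Params} {f : ℤ → ℤ → ℂ} {M N : ℤ} (h : IsFlatUpTo c f N)
    (hMN : M ≤ N) : IsFlatUpTo c f M :=
  ⟨h.support, h.lead20, h.lead11, h.lead02, fun i j hij => h.flat i j (by omega)⟩

/-- In this lemma and the next four, the equation at (N + 1, N + 1) has zero left-hand side, because
i = j there. Multiples of the off-diagonal equations of lower degree eliminate the off-diagonal
unknowns, and the three normalizations of degree two remove the rest. The substitutions for the
parameters encode the conditions already obtained; under them the undetermined diagonal coefficients
`f 2 2`, `f 3 3`, … cancel, so the result does not depend on the choice of the series. -/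
theorem IsFlatUpTo.focus_one {c : Params} {f : ℤ → ℤ → ℂ} (h : IsFlatUpTo c f 1)
    {a20 a11 a02 p q b20 b11 b02 : ℂ} (hc0 : c 0 = a20) (hc1 : c 1 = a11) (hc2 : c 2 = a02)
      (hc3 : c 3 = p) (hc4 : c 4 = q)
    (hc5 : c 5 = b20) (hc6 : c 6 = b11) (hc7 : c 7 = b02) :
    -a11 + b11 = 0 := by
  have e22 := h.flat 2 2 (by decide)
  simp only [cubicPart, hc0, hc1, hc2, hc3, hc4, hc5, hc6, hc7, Int.reduceSub,
    Int.reduceAdd, Int.reduceNeg, Int.cast_ofNat, Int.cast_one, Int.cast_zero,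
    h.support, Int.reduceLT, true_or, or_true]
    at e22
  linear_combination e22 + (2 * a02) * h.lead20 + (-2 * b20) * h.lead02
    + (-(-a11 + b11)) * h.lead11

theorem IsFlatUpTo.focus_two {c : Params} {f : ℤ → ℤ → ℂ} (h : IsFlatUpTo c f 2)
    {s a20 a02 p q b20 b02 : ℂ} (hc0 : c 0 = a20) (hc1 : c 1 = s) (hc2 : c 2 = a02)
      (hc3 : c 3 = p) (hc4 : c 4 = q)
    (hc5 : c 5 = b20) (hc6 : c 6 = s) (hc7 : c 7 = b02) :
    -a02 * a20 + b02 * b20 = 0 := by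
  have e33 := h.flat 3 3 (by decide)
  have e04 := h.flat 0 4 (by decide)
  have e13 := h.flat 1 3 (by decide)
  have e31 := h.flat 3 1 (by decide)
  have e40 := h.flat 4 0 (by decide)
  simp only [cubicPart, hc0, hc1, hc2, hc3, hc4, hc5, hc6, hc7, Int.reduceSub,
    Int.reduceAdd, Int.reduceNeg, Int.cast_ofNat, Int.cast_neg, Int.cast_one, Int.cast_zero,
    h.support, Int.reduceLT, true_or, or_true]
    at e33 e04 e13 e31 e40
  linear_combination e33 + (q) * e04 + (-1 / 2 * a20 + 3 / 2 * b20) * e13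
    + (3 / 2 * a02 - 1 / 2 * b02) * e31 + (p) * e40
    + (3 * a02 * s + a20 * p - b02 * s + 3 * b20 * p) * h.lead20
    + (-3 * a02 * q + a20 * s - b02 * q - 3 * b20 * s) * h.lead02
    + (-(-a02 * a20 + b02 * b20)) * h.lead11

/-- The rank-one form of the parameters solves the condition of `IsFlatUpTo.focus_two` identically
and makes the next condition factor. -/
theorem IsFlatUpTo.focus_three {c : Params} {f : ℤ → ℤ → ℂ} (h : IsFlatUpTo c f 3)
    {s t r u v p q : ℂ} (hc0 : c 0 = t * u) (hc1 : c 1 = s) (hc2 : c 2 = r * v) (hc3 : c 3 = p)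
      (hc4 : c 4 = q)
    (hc5 : c 5 = t * v) (hc6 : c 6 = s) (hc7 : c 7 = r * u) :
    -p * t ^ 2 * u * v - 3 / 8 * p * t ^ 2 * u ^ 2 + 3 / 8 * p * t ^ 2 * v ^ 2
      + q * r ^ 2 * u * v + 3 / 8 * q * r ^ 2 * u ^ 2 - 3 / 8 * q * r ^ 2 * v ^ 2 = 0 := by
  have e44 := h.flat 4 4 (by decide)
  have e15 := h.flat 1 5 (by decide)
  have e24 := h.flat 2 4 (by decide)
  have e42 := h.flat 4 2 (by decide)
  have e51 := h.flat 5 1 (by decide)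
  have e04 := h.flat 0 4 (by decide)
  have e13 := h.flat 1 3 (by decide)
  have e31 := h.flat 3 1 (by decide)
  have e40 := h.flat 4 0 (by decide)
  simp only [cubicPart, hc0, hc1, hc2, hc3, hc4, hc5, hc6, hc7, Int.reduceSub,
    Int.reduceAdd, Int.reduceNeg, Int.cast_ofNat, Int.cast_neg, Int.cast_one, Int.cast_zero,
    h.support, Int.reduceLT, true_or, or_true]
    at e44 e15 e24 e42 e51 e04 e13 e31 e40
  linear_combination e44 + (5 / 4 * q) * e15 + (-t * u + 2 * t * v) * e24
    + (-r * u + 2 * r * v) * e42 + (5 / 4 * p) * e51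
    + (5 / 4 * q * s - t ^ 2 * u * v + 2 * t ^ 2 * v ^ 2) * e04
    + (3 / 8 * q * r * u + 19 / 8 * q * r * v - s * t * u + 2 * s * t * v) * e13
    + (3 / 8 * p * t * u + 19 / 8 * p * t * v - r * s * u + 2 * r * s * v) * e31
    + (5 / 4 * p * s - r ^ 2 * u * v + 2 * r ^ 2 * v ^ 2) * e40
    + (3 / 4 * p * q * r * u + 19 / 4 * p * q * r * v + 5 / 4 * p * s * t * u
      + 35 / 4 * p * s * t * v - 2 * r * s ^ 2 * u + 4 * r * s ^ 2 * v
      + 4 * r ^ 2 * t * u * v ^ 2 - 2 * r ^ 2 * t * u ^ 2 * v) * h.lead20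
    + (-3 / 4 * p * q * t * u - 19 / 4 * p * q * t * v - 5 / 4 * q * r * s * u
      - 35 / 4 * q * r * s * v - 4 * r * t ^ 2 * u * v ^ 2 + 2 * r * t ^ 2 * u ^ 2 * v
      + 2 * s ^ 2 * t * u - 4 * s ^ 2 * t * v) * h.lead02
    + (-(-p * t ^ 2 * u * v - 3 / 8 * p * t ^ 2 * u ^ 2 + 3 / 8 * p * t ^ 2 * v ^ 2
      + q * r ^ 2 * u * v + 3 / 8 * q * r ^ 2 * u ^ 2 - 3 / 8 * q * r ^ 2 * v ^ 2)) * h.lead11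

/-- Specialized to the factor u = -3v of the third condition, the only case in which more
information is needed. -/
theorem IsFlatUpTo.focus_four {c : Params} {f : ℤ → ℤ → ℂ} (h : IsFlatUpTo c f 4)
    {s t r p q : ℂ} (hc0 : c 0 = -3 * t) (hc1 : c 1 = s) (hc2 : c 2 = r) (hc3 : c 3 = p)
      (hc4 : c 4 = q)
    (hc5 : c 5 = t) (hc6 : c 6 = s) (hc7 : c 7 = -3 * r) :
    5 * p * s * t ^ 2 - 5 * q * r ^ 2 * s = 0 := by
  have e55 := h.flat 5 5 (by decide)
  have e26 := h.flat 2 6 (by decide)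
  have e35 := h.flat 3 5 (by decide)
  have e53 := h.flat 5 3 (by decide)
  have e62 := h.flat 6 2 (by decide)
  have e06 := h.flat 0 6 (by decide)
  have e15 := h.flat 1 5 (by decide)
  have e24 := h.flat 2 4 (by decide)
  have e42 := h.flat 4 2 (by decide)
  have e51 := h.flat 5 1 (by decide)
  have e60 := h.flat 6 0 (by decide)
  have e04 := h.flat 0 4 (by decide)
  have e13 := h.flat 1 3 (by decide)
  have e31 := h.flat 3 1 (by decide)
  have e40 := h.flat 4 0 (by decide)
  simp only [cubicPart, hc0, hc1, hc2, hc3, hc4, hc5, hc6, hc7, Int.reduceSub,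
    Int.reduceAdd, Int.reduceNeg, Int.cast_ofNat, Int.cast_neg, Int.cast_one, Int.cast_zero,
    h.support, Int.reduceLT, true_or, or_true]
    at e55 e26 e35 e53 e62 e06 e15 e24 e42 e51 e60 e04 e13 e31 e40
  linear_combination e55 + (3 / 2 * q) * e26 + (7 * t) * e35 + (7 * r) * e53
    + (3 / 2 * p) * e62 + (17 / 2 * q * t) * e06 + (3 / 2 * q * s + 14 * t ^ 2) * e15
    + (7 / 2 * q * r + 7 * s * t) * e24 + (7 / 2 * p * t + 7 * r * s) * e42
    + (3 / 2 * p * s + 14 * r ^ 2) * e51 + (17 / 2 * p * r) * e60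
    + (-22 * q * r * t + 3 / 2 * q * s ^ 2 + 21 * s * t ^ 2) * e04
    + (p * q * t + 13 / 2 * q * r * s - 70 * r * t ^ 2 + 7 * s ^ 2 * t) * e13
    + (p * q * r + 13 / 2 * p * s * t + 7 * r * s ^ 2 - 70 * r ^ 2 * t) * e31
    + (-22 * p * r * t + 3 / 2 * p * s ^ 2 + 21 * r ^ 2 * s) * e40
    + (15 * p * q * r * s - 8 * p * r * t ^ 2 + 18 * p * s ^ 2 * t + 2 * p ^ 2 * q * t
      + 14 * r * s ^ 3 - 266 * r ^ 2 * s * t) * h.lead20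
    + (-15 * p * q * s * t - 2 * p * q ^ 2 * r - 18 * q * r * s ^ 2 + 8 * q * r ^ 2 * t
      + 266 * r * s * t ^ 2 - 14 * s ^ 3 * t) * h.lead02
    + (-(5 * p * s * t ^ 2 - 5 * q * r ^ 2 * s)) * h.lead11

theorem IsFlatUpTo.focus_five {c : Params} {f : ℤ → ℤ → ℂ} (h : IsFlatUpTo c f 5)
    {t r p q : ℂ} (hc0 : c 0 = -3 * t) (hc1 : c 1 = 0) (hc2 : c 2 = r) (hc3 : c 3 = p)
      (hc4 : c 4 = q)
    (hc5 : c 5 = t) (hc6 : c 6 = 0) (hc7 : c 7 = -3 * r) :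
    -5 / 3 * p * q ^ 2 * r ^ 2 - 20 / 3 * p * r * t ^ 3 + 5 / 3 * p ^ 2 * q * t ^ 2
      + 20 / 3 * q * r ^ 3 * t = 0 := by
  have e66 := h.flat 6 6 (by decide)
  have e37 := h.flat 3 7 (by decide)
  have e46 := h.flat 4 6 (by decide)
  have e64 := h.flat 6 4 (by decide)
  have e73 := h.flat 7 3 (by decide)
  have e08 := h.flat 0 8 (by decide)
  have e17 := h.flat 1 7 (by decide)
  have e26 := h.flat 2 6 (by decide)
  have e35 := h.flat 3 5 (by decide)
  have e53 := h.flat 5 3 (by decide)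
  have e62 := h.flat 6 2 (by decide)
  have e71 := h.flat 7 1 (by decide)
  have e80 := h.flat 8 0 (by decide)
  have e06 := h.flat 0 6 (by decide)
  have e15 := h.flat 1 5 (by decide)
  have e24 := h.flat 2 4 (by decide)
  have e42 := h.flat 4 2 (by decide)
  have e51 := h.flat 5 1 (by decide)
  have e60 := h.flat 6 0 (by decide)
  have e04 := h.flat 0 4 (by decide)
  have e13 := h.flat 1 3 (by decide)
  have e31 := h.flat 3 1 (by decide)
  have e40 := h.flat 4 0 (by decide)
  simp only [cubicPart, hc0, hc1, hc2, hc3, hc4, hc5, hc6, hc7, Int.reduceSub,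
    Int.reduceAdd, Int.reduceNeg, Int.cast_ofNat, Int.cast_neg, Int.cast_one, Int.cast_zero,
    h.support, Int.reduceLT, true_or, or_true]
    at e66 e37 e46 e64 e73 e08 e17 e26 e35 e53 e62 e71 e80 e06 e15 e24 e42 e51 e60 e04 e13 e31 e40
  linear_combination e66 + (7 / 4 * q) * e37 + (9 * t) * e46 + (9 * r) * e64
    + (7 / 4 * p) * e73 + (7 / 4 * q ^ 2) * e08 + (161 / 12 * q * t) * e17 + (27 * t ^ 2) * e26
    + (27 / 4 * q * r) * e35 + (27 / 4 * p * t) * e53 + (27 * r ^ 2) * e62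
    + (161 / 12 * p * r) * e71 + (7 / 4 * p ^ 2) * e80 + (3 / 2 * q ^ 2 * r + 27 * t ^ 3) * e06
    + (-7 / 16 * p * q ^ 2 - 241 / 6 * q * r * t) * e15
    + (1 / 12 * p * q * t - 189 * r * t ^ 2) * e24 + (1 / 12 * p * q * r - 189 * r ^ 2 * t) * e42
    + (-241 / 6 * p * r * t - 7 / 16 * p ^ 2 * q) * e51 + (3 / 2 * p ^ 2 * t + 27 * r ^ 3) * e60
    + (1 / 12 * p * q * t ^ 2 - 9 / 2 * q ^ 2 * r ^ 2 - 270 * r * t ^ 3) * e04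
    + (25 / 16 * p * q ^ 2 * r - 27 / 2 * p * t ^ 3 - 248 / 3 * q * r ^ 2 * t) * e13
    + (-248 / 3 * p * r * t ^ 2 + 25 / 16 * p ^ 2 * q * t - 27 / 2 * q * r ^ 3) * e31
    + (1 / 12 * p * q * r ^ 2 - 9 / 2 * p ^ 2 * t ^ 2 - 270 * r ^ 3 * t) * e40
    + (-995 / 6 * p * q * r ^ 2 * t + 25 / 8 * p ^ 2 * q ^ 2 * r + 1620 * r ^ 3 * t ^ 2) * h.lead20
    + (995 / 6 * p * q * r * t ^ 2 - 25 / 8 * p ^ 2 * q ^ 2 * t - 1620 * r ^ 2 * t ^ 3) * h.lead02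
    + (-(-5 / 3 * p * q ^ 2 * r ^ 2 - 20 / 3 * p * r * t ^ 3 + 5 / 3 * p ^ 2 * q * t ^ 2
      + 20 / 3 * q * r ^ 3 * t)) * h.lead11

theorem IsLyapunovSeries.isFlatUpTo {Ψ : MvPowerSeries (Fin 2) Coeffs} {g : ℕ → Coeffs}
    (h : IsLyapunovSeries Ψ g) {c : Params} {m : ℕ}
    (hc : ∀ k, 1 ≤ k → k ≤ m → MvPolynomial.eval c (g k) = 0) :
    IsFlatUpTo c (coef (MvPowerSeries.map (MvPolynomial.eval c) Ψ)) m := by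
  obtain ⟨h1, h2⟩ := isLyapunovSeries_iff.1 h
  refine ⟨fun i j hij => coef_of_neg hij, ?_, ?_, ?_, fun i j hij => ?_⟩
  · rw [coef_map, h1 _ _ (by decide)]; simp
  · rw [coef_map, h1 _ _ (by decide)]; simp
  · rw [coef_map, h1 _ _ (by decide)]; simp
  · have e := coef_lieD_map (MvPolynomial.eval c) MvPolynomial.X Ψ i j
    simp only [MvPolynomial.eval_X] at e
    rw [coef_lieD, h2, sub_eq_iff_eq_add] at e
    rw [e, add_eq_right]
    split_ifs with h
    · exact hc _ (by omega) (by omega)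
    · exact map_zero _

theorem IsFlatUpTo.mem_union {c : Params} {f : ℤ → ℤ → ℂ} (h : IsFlatUpTo c f 5) :
    c ∈ variety J1 ∪ variety J2 ∪ variety J3 := by
  have g1 := (h.mono (by decide : (1 : ℤ) ≤ 5)).focus_one rfl rfl rfl rfl rfl rfl rfl rfl
  have h16 : c 1 = c 6 := by linear_combination -g1
  have g2 := (h.mono (by decide : (2 : ℤ) ≤ 5)).focus_two rfl h16 rfl rfl rfl rfl rfl rfl
  obtain ⟨t, r, u, v, e0, e5, e7, e2⟩ := exists_factors_of_mul_eq_mul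
    (a := c 0) (b := c 5) (c := c 7) (d := c 2) (by linear_combination -g2)
  have g3 := (h.mono (by decide : (3 : ℤ) ≤ 5)).focus_three e0 h16 e2 rfl rfl e5 rfl e7
  -- The three factors correspond to `J1`, `J2` and `J3`.
  have g3' : (3 * u - v) * ((u + 3 * v) * (t ^ 2 * c 3 - r ^ 2 * c 4)) = 0 := by
    linear_combination -8 * g3
  rcases mul_eq_zero.1 g3' with h1 | h1
  · refine Or.inl (Or.inl (mem_variety_J1.2 ⟨h16, ?_, ?_⟩))
    · linear_combination 3 * e0 - e5 + t * h1
    · linear_combination 3 * e7 - e2 + r * h1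
  by_cases hK : t ^ 2 * c 3 - r ^ 2 * c 4 = 0
  · refine Or.inr (mem_variety_J3.2 ⟨?_, ?_, ?_, h16, ?_⟩)
    · rw [e0, e7]; linear_combination u ^ 2 * hK
    · rw [e0, e2, e5, e7]; ring
    · rw [e0, e2, e5, e7]; linear_combination u * v * hK
    · rw [e2, e5]; linear_combination -v ^ 2 * hK
  have huv : u = -3 * v := by linear_combination (mul_eq_zero.1 h1).resolve_right hK
  -- Then u = 0 too, the four coefficients of the matrix vanish, and the point already lies on
  -- V(J₁).
  by_cases hv : v = 0
  · refine Or.inl (Or.inl (mem_variety_J1.2 ⟨h16, ?_, ?_⟩)) <;> simp [*]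
  have hK' : c 5 ^ 2 * c 3 - c 2 ^ 2 * c 4 ≠ 0 := by
    have : c 5 ^ 2 * c 3 - c 2 ^ 2 * c 4 = v ^ 2 * (t ^ 2 * c 3 - r ^ 2 * c 4) := by
      rw [e2, e5]; ring
    rw [this]
    exact mul_ne_zero (pow_ne_zero 2 hv) hK
  have e0' : c 0 = -3 * c 5 := by rw [e0, e5, huv]; ring
  have e7' : c 7 = -3 * c 2 := by rw [e7, e2, huv]; ring
  have g4 := (h.mono (by decide : (4 : ℤ) ≤ 5)).focus_four e0' h16 rfl rfl rfl rfl rfl e7'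
  have h6 : c 6 = 0 := by
    refine (mul_eq_zero.1 (?_ : c 6 * (c 5 ^ 2 * c 3 - c 2 ^ 2 * c 4) = 0)).resolve_right hK'
    linear_combination g4 / 5
  have h1 : c 1 = 0 := h16.trans h6
  have g5 := h.focus_five e0' h1 rfl rfl rfl rfl h6 e7'
  -- The fifth condition is, up to a constant, the product of this expression and the nonzero
  -- quantity of `hK'`.
  have h34 : c 3 * c 4 - 4 * c 2 * c 5 = 0 := by
    refine (mul_eq_zero.1 (?_ : _ * (c 5 ^ 2 * c 3 - c 2 ^ 2 * c 4) = 0)).resolve_right hK'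
    linear_combination 3 / 5 * g5
  refine Or.inl (Or.inr (mem_variety_J2.2 ⟨h1, h6, ?_, ?_, ?_⟩))
  · linear_combination e0'
  · linear_combination e7'
  · linear_combination h34

theorem variety_bautinIdealUpTo_five_subset {Ψ : MvPowerSeries (Fin 2) Coeffs} {g : ℕ → Coeffs}
    (h : IsLyapunovSeries Ψ g) :
    variety (bautinIdealUpTo g 5) ⊆ variety J1 ∪ variety J2 ∪ variety J3 := fun _ hc =>
  (h.isFlatUpTo (mem_variety_bautinIdealUpTo.1 hc)).mem_union

end

end CubicCenter

namespace CubicCenter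

noncomputable section

/-! ### Power series of given order -/

/-- The ideal of the power series without terms of degree less than `N`. -/
def ordIdeal (N : ℕ) : Ideal (MvPowerSeries (Fin 2) ℂ) where
  carrier := {F | (N : ℕ∞) ≤ F.order}
  add_mem' := fun ha hb => (le_min ha hb).trans MvPowerSeries.min_order_le_add
  zero_mem' := by simp [MvPowerSeries.order_zero]
  smul_mem' := fun _ _ h => (h.trans le_add_self).trans MvPowerSeries.le_order_mul

theorem mem_ordIdeal {N : ℕ} {F : MvPowerSeries (Fin 2) ℂ} :
    F ∈ ordIdeal N ↔ ∀ i j : ℤ, i + j < N → coef F i j = 0 := by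
  change (N : ℕ∞) ≤ F.order ↔ _
  constructor
  · intro h i j hij
    by_cases h' : 0 ≤ i ∧ 0 ≤ j
    · lift i to ℕ using h'.1
      lift j to ℕ using h'.2
      rw [coef_natCast]
      refine MvPowerSeries.coeff_of_lt_order (lt_of_lt_of_le ?_ h)
      have : (expo i j).degree = i + j := by simp [expo]
      rw [this]
      exact_mod_cast hij
    · exact coef_of_neg (by omega)
  · intro h
    refine MvPowerSeries.nat_le_order fun d hd => ?_
    rw [coeff_eq_coef]
    have : d.degree = d 0 + d 1 := by simp [Finsupp.degree_eq_sum]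
    exact h _ _ (by omega)

theorem ordIdeal_anti {M N : ℕ} (h : M ≤ N) : ordIdeal N ≤ ordIdeal M := fun _ hF =>
  mem_ordIdeal.2 fun i j hij => mem_ordIdeal.1 hF i j (by omega)

theorem mul_mem_ordIdeal {M N : ℕ} {F G : MvPowerSeries (Fin 2) ℂ} (hF : F ∈ ordIdeal M)
    (hG : G ∈ ordIdeal N) : F * G ∈ ordIdeal (M + N) := by
  refine le_trans ?_ MvPowerSeries.le_order_mul
  push_cast
  exact add_le_add hF hG

theorem pow_mem_ordIdeal {M : ℕ} {F : MvPowerSeries (Fin 2) ℂ} (hF : F ∈ ordIdeal M) (n : ℕ) :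
    F ^ n ∈ ordIdeal (n * M) := by
  induction n with
  | zero => exact mem_ordIdeal.2 fun i j h => coef_of_neg (by simp at h; omega)
  | succ n ih =>
    rw [pow_succ, add_mul, one_mul]
    exact mul_mem_ordIdeal ih hF

/-- The product `x y` of the phase variables, as a power series. -/
def xy : MvPowerSeries (Fin 2) ℂ := MvPowerSeries.X 0 * MvPowerSeries.X 1

theorem coef_one {R : Type*} [CommRing R] (i j : ℤ) :
    coef (1 : MvPowerSeries (Fin 2) R) i j = if i = 0 ∧ j = 0 then 1 else 0 := by
  by_cases h : 0 ≤ i ∧ 0 ≤ j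
  · lift i to ℕ using h.1
    lift j to ℕ using h.2
    rw [coef_natCast, MvPowerSeries.coeff_one]
    congr 1
    simp only [eq_iff_iff]
    constructor
    · intro h
      have h0 := DFunLike.congr_fun h 0
      have h1 := DFunLike.congr_fun h 1
      simp at h0 h1
      simp [h0, h1]
    · rintro ⟨h0, h1⟩
      simp at h0 h1
      simp [expo, h0, h1]
  · rw [coef_of_neg (by omega), if_neg (by omega)]

theorem coef_xy_pow (m : ℕ) (i j : ℤ) :
    coef (xy ^ m) i j = if i = m ∧ j = m then 1 else 0 := by
  induction m generalizing i j with
  | zero => simp [coef_one]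
  | succ m ih =>
    rw [pow_succ', xy, mul_assoc, coef_X_zero_mul, coef_X_one_mul, ← xy, ih]
    congr 1
    simp only [eq_iff_iff]
    omega

theorem xy_pow_mem_ordIdeal (m : ℕ) : xy ^ m ∈ ordIdeal (2 * m) :=
  mem_ordIdeal.2 fun i j h => by rw [coef_xy_pow, if_neg (by omega)]

/-- In degrees up to N the cubic part only sees coefficients of degree less than N, which vanish. -/
theorem coef_lieD_of_mem_ordIdeal (c : Params) {N : ℕ} {F : MvPowerSeries (Fin 2) ℂ}
    (hF : F ∈ ordIdeal N) {i j : ℤ} (h : i + j ≤ N) :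
    coef (lieD c F) i j = (i - j : ℤ) * coef F i j := by
  rw [mem_ordIdeal] at hF
  rw [coef_lieD, cubicPart, hF (i - 2) j (by omega), hF (i - 1) (j - 1) (by omega),
    hF i (j - 2) (by omega), hF (i + 1) (j - 3) (by omega), hF (i - 3) (j + 1) (by omega)]
  ring

theorem coef_eq_zero_of_lieD_mem (c : Params) {N : ℕ} {F : MvPowerSeries (Fin 2) ℂ}
    (hF : F ∈ ordIdeal N) (hD : lieD c F ∈ ordIdeal (N + 1)) {i j : ℤ} (h : i + j ≤ N)
    (hij : i ≠ j) : coef F i j = 0 := by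
  have e := coef_lieD_of_mem_ordIdeal c hF h
  rw [mem_ordIdeal.1 hD i j (by push_cast; omega), eq_comm, mul_eq_zero] at e
  refine e.resolve_left ?_
  exact_mod_cast sub_ne_zero.2 hij

/-- The kernel of the linear part is spanned by the powers of x y, none of which has odd degree. -/
theorem mem_ordIdeal_succ_of_odd (c : Params) {m : ℕ} {F : MvPowerSeries (Fin 2) ℂ}
    (hF : F ∈ ordIdeal (2 * m + 1)) (hD : lieD c F ∈ ordIdeal (2 * m + 2)) :
    F ∈ ordIdeal (2 * m + 2) :=
  mem_ordIdeal.2 fun i j h =>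
    if hij : i = j then mem_ordIdeal.1 hF i j (by push_cast at h ⊢; omega)
    else coef_eq_zero_of_lieD_mem c hF hD (by push_cast at h ⊢; omega) hij

theorem sub_mem_ordIdeal_succ_of_even (c : Params) {m : ℕ} {F : MvPowerSeries (Fin 2) ℂ}
    (hF : F ∈ ordIdeal (2 * m)) (hD : lieD c F ∈ ordIdeal (2 * m + 1)) :
    F - MvPowerSeries.C (coef F m m) * xy ^ m ∈ ordIdeal (2 * m + 1) :=
  mem_ordIdeal.2 fun i j h => by
    rw [coef_sub, coef_C_mul, coef_xy_pow]
    by_cases hij : i = j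
    · by_cases him : i = m
      · simp [← hij, him]
      · rw [mem_ordIdeal.1 hF i j (by push_cast at h ⊢; omega), if_neg (by omega)]
        simp
    · rw [coef_eq_zero_of_lieD_mem c hF hD (by push_cast at h ⊢; omega) hij, if_neg (by omega)]
      simp

theorem pow_sub_xy_pow_mem {F : MvPowerSeries (Fin 2) ℂ} (hF : F - xy ∈ ordIdeal 3) (m : ℕ) :
    F ^ m - xy ^ m ∈ ordIdeal (2 * m + 1) := by
  have h2 : F ∈ ordIdeal 2 := by
    have := Ideal.add_mem _ (ordIdeal_anti (by norm_num : 2 ≤ 3) hF)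
      (by simpa using xy_pow_mem_ordIdeal 1)
    simpa using this
  induction m with
  | zero => simp
  | succ m ih =>
    have e : F ^ (m + 1) - xy ^ (m + 1) = F ^ m * (F - xy) + (F ^ m - xy ^ m) * xy := by ring
    rw [e]
    refine Ideal.add_mem _ (ordIdeal_anti ?_ (mul_mem_ordIdeal (pow_mem_ordIdeal h2 m) hF))
      (ordIdeal_anti ?_ (mul_mem_ordIdeal ih
        (by simpa using xy_pow_mem_ordIdeal 1 : xy ∈ ordIdeal 2))) <;> omega

/-! ### A formal first integral makes all focus quantities vanish -/

/-- If `F = x y + ⋯` has derivative `γ (x y) ^ (k + 1) + ⋯` with `γ ≠ 0` along the system, then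
all formal first integrals of the system are constant. -/
theorem sub_C_mem_ordIdeal_of_lieD_eq_zero {c : Params} {F : MvPowerSeries (Fin 2) ℂ} {k : ℕ}
    {γ : ℂ} (hγ : γ ≠ 0) (hF : F - xy ∈ ordIdeal 3)
    (hR : lieD c F - MvPowerSeries.C γ * xy ^ (k + 1) ∈ ordIdeal (2 * k + 3))
    {Φ : MvPowerSeries (Fin 2) ℂ} (hΦ : lieD c Φ = 0) (N : ℕ) :
    Φ - MvPowerSeries.C (coef Φ 0 0) ∈ ordIdeal N := by
  have hF2 : F ∈ ordIdeal 2 := by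
    have := Ideal.add_mem _ (ordIdeal_anti (by norm_num : 2 ≤ 3) hF)
      (by simpa using xy_pow_mem_ordIdeal 1)
    simpa using this
  have hR2 : lieD c F ∈ ordIdeal (2 * k + 2) := by
    have := Ideal.add_mem _ (ordIdeal_anti (by omega : 2 * k + 2 ≤ 2 * k + 3) hR)
      (Ideal.mul_mem_left _ (MvPowerSeries.C γ) (xy_pow_mem_ordIdeal (k + 1)))
    simpa using this
  have hC : ∀ a : ℂ, lieD c (MvPowerSeries.C a) = 0 := fun a => by simp [lieD_apply]
  set E := Φ - MvPowerSeries.C (coef Φ 0 0) with hE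
  have hDE : lieD c E = 0 := by rw [hE, map_sub, hΦ, hC, sub_zero]
  -- If E had a first nonzero term e (x y)^M with M ≥ 1, then subtracting e F^M and multiples of
  -- higher powers of F would leave a remainder of order 2(M + k). The derivative of this remainder
  -- would have diagonal term -M e γ (x y)^(M + k), but on terms of lowest degree the derivation
  -- produces no diagonal term. Below, M is m + 1.
  induction N with
  | zero => exact mem_ordIdeal.2 fun i j h => coef_of_neg (by simp at h; omega)
  | succ N ih =>
    rcases Nat.even_or_odd' N with ⟨m, rfl | rfl⟩
    swap
    · exact mem_ordIdeal_succ_of_odd c ih (by rw [hDE]; exact Ideal.zero_mem _)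
    have h1 := sub_mem_ordIdeal_succ_of_even c ih (by rw [hDE]; exact Ideal.zero_mem _)
    set e := coef E m m with he
    by_cases hm : m = 0
    · subst hm
      have : e = 0 := by
        have : coef (MvPowerSeries.C (coef Φ 0 0)) 0 0 = coef Φ 0 0 := by
          rw [← mul_one (MvPowerSeries.C _), coef_C_mul, coef_one]; simp
        rw [he, hE, coef_sub]
        simp only [Nat.cast_zero, this, sub_self]
      simpa [this] using h1
    by_cases he0 : e = 0
    · simpa [he0] using h1
    exfalso
    obtain ⟨m, rfl⟩ : ∃ n, m = n + 1 := Nat.exists_eq_succ_of_ne_zero hm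
    -- S stands for a polynomial in F and T for its formal derivative in F; only the chain rule
    -- relating them is needed.
    have hderiv : ∀ S T, lieD c S = T * lieD c F →
        lieD c (E - MvPowerSeries.C e * F ^ (m + 1) - F ^ (m + 2) * S)
          = -(MvPowerSeries.C e *
              (((m + 1 : ℕ) : MvPowerSeries (Fin 2) ℂ) * (F ^ m * lieD c F)))
            - F ^ (m + 1) * ((((m + 2 : ℕ) : MvPowerSeries (Fin 2) ℂ) * S + F * T) * lieD c F) := by
      intro S T h
      simp only [map_sub, hDE, Derivation.leibniz, Derivation.leibniz_pow, hC, h, smul_eq_mul,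
        nsmul_eq_mul, add_tsub_cancel_right, Nat.reduceSubDiff]
      push_cast
      ring
    have htail : ∀ S T, F ^ (m + 1) * (((m + 2 : ℕ) * S + F * T) * lieD c F)
        ∈ ordIdeal (2 * (m + 1 + k) + 1) := fun S T =>
      ordIdeal_anti (by omega) (mul_mem_ordIdeal (pow_mem_ordIdeal hF2 (m + 1))
        (Ideal.mul_mem_left _ _ hR2))
    have hhead : F ^ m * lieD c F ∈ ordIdeal (2 * (m + 1 + k)) :=
      ordIdeal_anti (by omega) (mul_mem_ordIdeal (pow_mem_ordIdeal hF2 m) hR2)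
    have hDmem : ∀ S T, lieD c S = T * lieD c F →
        lieD c (E - MvPowerSeries.C e * F ^ (m + 1) - F ^ (m + 2) * S)
          ∈ ordIdeal (2 * (m + 1 + k)) := by
      intro S T h
      rw [hderiv S T h]
      exact Ideal.sub_mem _ ((Ideal.neg_mem_iff _).2 (Ideal.mul_mem_left _ _
        (Ideal.mul_mem_left _ _ hhead))) (ordIdeal_anti (by omega) (htail S T))
    -- The order of the remainder is raised one degree at a time, capped at 2(m + 1 + k), the order
    -- of its derivative. Odd degrees are free; in even degree the diagonal term a (x y)^(l + m + 2)
    -- is removed by adding a F^l to S.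
    have step : ∀ n, n + 2 * (m + 1) + 1 ≤ 2 * (m + 1 + k) + 1 →
        ∃ S T, lieD c S = T * lieD c F ∧
          E - MvPowerSeries.C e * F ^ (m + 1) - F ^ (m + 2) * S
            ∈ ordIdeal (min (n + 2 * (m + 1) + 1) (2 * (m + 1 + k))) := by
      intro n
      induction n with
      | zero =>
        intro _
        refine ⟨0, 0, by simp, ordIdeal_anti (min_le_left _ _)
          (ordIdeal_anti (N := 2 * (m + 1) + 1) (by omega) ?_)⟩
        have := Ideal.sub_mem _ h1 (Ideal.mul_mem_left _ (MvPowerSeries.C e)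
          (pow_sub_xy_pow_mem hF (m + 1)))
        convert this using 1
        ring
      | succ n ih' =>
        intro hn
        obtain ⟨S, T, hST, hS⟩ := ih' (by omega)
        rw [min_eq_left (by omega)] at hS
        have hD := hDmem S T hST
        rcases Nat.even_or_odd' n with ⟨l, rfl | rfl⟩
        · refine ⟨S, T, hST, ordIdeal_anti (min_le_left _ _) ?_⟩
          have := mem_ordIdeal_succ_of_odd c (m := l + (m + 1))
            (ordIdeal_anti (by omega) hS) (ordIdeal_anti (by omega) hD)
          exact ordIdeal_anti (by omega) this
        · by_cases hend : 2 * l + 1 + 1 + 2 * (m + 1) + 1 = 2 * (m + 1 + k) + 1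
          · exact ⟨S, T, hST, ordIdeal_anti (by omega) hS⟩
          have h2 := sub_mem_ordIdeal_succ_of_even c (m := l + (m + 2))
            (ordIdeal_anti (by omega) hS) (ordIdeal_anti (by omega) hD)
          set a := coef (E - MvPowerSeries.C e * F ^ (m + 1) - F ^ (m + 2) * S)
            (l + (m + 2) : ℕ) (l + (m + 2) : ℕ)
          -- For l = 0 the truncated exponent l - 1 is harmless, since its coefficient is l.
          refine ⟨S + MvPowerSeries.C a * F ^ l,
            T + MvPowerSeries.C a * ((l : MvPowerSeries (Fin 2) ℂ) * F ^ (l - 1)), ?_,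
            ordIdeal_anti (min_le_left _ _) ?_⟩
          · simp only [map_add, Derivation.leibniz, Derivation.leibniz_pow, hC, hST, smul_eq_mul,
              nsmul_eq_mul]
            ring
          · have := Ideal.sub_mem _ h2 (Ideal.mul_mem_left _ (MvPowerSeries.C a)
              (pow_sub_xy_pow_mem hF (l + (m + 2))))
            refine ordIdeal_anti (by omega : _ ≤ 2 * (l + (m + 2)) + 1) ?_
            convert this using 1
            ring
    obtain ⟨S, T, hST, hS⟩ := step (2 * k) (by omega)
    rw [min_eq_right (by omega)] at hS
    -- The factor i - j makes this diagonal coefficient zero; the rest of the proof computes it as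
    -- -(m + 1) e γ.
    have z := coef_lieD_of_mem_ordIdeal c hS
      (i := (m + 1 + k : ℕ)) (j := (m + 1 + k : ℕ)) (by push_cast; omega)
    have hlead : F ^ m * lieD c F - MvPowerSeries.C γ * xy ^ (m + 1 + k)
        ∈ ordIdeal (2 * (m + 1 + k) + 1) := by
      have e1 : F ^ m * lieD c F - MvPowerSeries.C γ * xy ^ (m + 1 + k)
          = F ^ m * (lieD c F - MvPowerSeries.C γ * xy ^ (k + 1))
            + (F ^ m - xy ^ m) * (MvPowerSeries.C γ * xy ^ (k + 1)) := by ring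
      rw [e1]
      exact Ideal.add_mem _
        (ordIdeal_anti (by omega) (mul_mem_ordIdeal (pow_mem_ordIdeal hF2 m) hR))
        (ordIdeal_anti (by omega) (mul_mem_ordIdeal (pow_sub_xy_pow_mem hF m)
          (Ideal.mul_mem_left _ _ (xy_pow_mem_ordIdeal (k + 1)))))
    have hcoef : coef (F ^ m * lieD c F) (m + 1 + k : ℕ) (m + 1 + k : ℕ) = γ := by
      have := mem_ordIdeal.1 hlead (m + 1 + k : ℕ) (m + 1 + k : ℕ) (by push_cast; omega)
      rw [coef_sub, coef_C_mul, coef_xy_pow, sub_eq_zero] at this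
      simpa using this
    have hcast : ((m + 1 : ℕ) : MvPowerSeries (Fin 2) ℂ) = MvPowerSeries.C ((m + 1 : ℕ) : ℂ) :=
      (map_natCast _ _).symm
    rw [hderiv S T hST, coef_sub, coef_neg,
      mem_ordIdeal.1 (htail S T) (m + 1 + k : ℕ) (m + 1 + k : ℕ) (by push_cast; omega),
      coef_C_mul, hcast, coef_C_mul, hcoef, sub_self, Int.cast_zero, zero_mul, sub_zero,
      neg_eq_zero] at z
    have hm' : ((m + 1 : ℕ) : ℂ) ≠ 0 := Nat.cast_ne_zero.2 m.succ_ne_zero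
    exact mul_ne_zero he0 (mul_ne_zero hm' hγ) z

/-- At the least k with nonvanishing focus quantity, `sub_C_mem_ordIdeal_of_lieD_eq_zero` would make
Φ agree with its constant term to every order. -/
theorem IsLyapunovSeries.mem_centerVariety_of_firstIntegral {Ψ : MvPowerSeries (Fin 2) Coeffs}
    {g : ℕ → Coeffs} (h : IsLyapunovSeries Ψ g) {c : Params} {Φ : MvPowerSeries (Fin 2) ℂ}
    (hΦ : lieD c Φ = 0) (hne : ∀ a : ℂ, Φ ≠ MvPowerSeries.C a) : c ∈ centerVariety g := by
  rw [mem_centerVariety]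
  by_contra! hk
  classical
  obtain ⟨hk1, hk0⟩ := Nat.find_spec hk
  set k := Nat.find hk
  have hmin : ∀ l, 1 ≤ l → l < k → MvPolynomial.eval c (g l) = 0 := fun l hl hlk => by
    have := Nat.find_min hk hlk
    tauto
  obtain ⟨h1, h2⟩ := isLyapunovSeries_iff.1 h
  set F := MvPowerSeries.map (MvPolynomial.eval c) Ψ with hFdef
  have hD : ∀ i j, coef (lieD c F) i j = MvPolynomial.eval c
      (if i = j ∧ 2 ≤ i then g (i.toNat - 1) else 0) := by
    intro i j
    have e := coef_lieD_map (MvPolynomial.eval c) MvPolynomial.X Ψ i j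
    simp only [MvPolynomial.eval_X] at e
    rw [e, h2]
  refine hne (coef Φ 0 0) (sub_eq_zero.1 (ext_coef fun i j => ?_))
  have hF : F - xy ∈ ordIdeal 3 := by
    refine mem_ordIdeal.2 fun i j hij => ?_
    rw [coef_sub, ← pow_one xy, coef_xy_pow, hFdef, coef_map, h1 _ _ (by push_cast at hij; omega)]
    split_ifs <;> simp_all
  have hR : lieD c F - MvPowerSeries.C (MvPolynomial.eval c (g k)) * xy ^ (k + 1)
      ∈ ordIdeal (2 * k + 3) := by
    refine mem_ordIdeal.2 fun i j hij => ?_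
    rw [coef_sub, coef_C_mul, coef_xy_pow, hD]
    by_cases hd : i = j ∧ 2 ≤ i
    · rw [if_pos hd]
      by_cases hik : i = k + 1
      · rw [if_pos (by push_cast; omega), mul_one, sub_eq_zero]
        congr 2
        omega
      · rw [if_neg (by push_cast; omega), mul_zero, sub_zero]
        exact hmin _ (by omega) (by push_cast at hij; omega)
    · rw [if_neg hd, if_neg (by push_cast; omega)]
      simp
  have := mem_ordIdeal.1 (sub_C_mem_ordIdeal_of_lieD_eq_zero hk0 hF hR hΦ (i + j + 1).toNat)
  by_cases hij : 0 ≤ i + j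
  · rw [this i j (by omega)]
    simp [coef]
  · rw [coef_of_neg (by omega), coef_of_neg (by omega)]

end

end CubicCenter

namespace CubicCenter

noncomputable section

/-! ### Hamiltonian systems -/

theorem coef_cubicP {R : Type*} [CommRing R] (c : Fin 8 → R) (i j : ℤ) :
    coef (cubicP c : MvPowerSeries (Fin 2) R) i j = coef 1 (i - 1) j - c 0 * coef 1 (i - 3) j
      - c 1 * coef 1 (i - 2) (j - 1) - c 2 * coef 1 (i - 1) (j - 2) - c 3 * coef 1 i (j - 3) := by
  open MvPowerSeries in
  have e : (cubicP c : MvPowerSeries (Fin 2) R) = X 0 * 1 - C (c 0) * (X 0 * (X 0 * (X 0 * 1)))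
      - C (c 1) * (X 0 * (X 0 * (X 1 * 1))) - C (c 2) * (X 0 * (X 1 * (X 1 * 1)))
      - C (c 3) * (X 1 * (X 1 * (X 1 * 1))) := by
    rw [cubicP]
    simp only [← MvPolynomial.coeToMvPowerSeries.ringHom_apply, map_sub, map_mul, map_pow]
    simp only [MvPolynomial.coeToMvPowerSeries.ringHom_apply, MvPolynomial.coe_X,
      MvPolynomial.coe_C]
    ring
  simp only [e, coef_sub, coef_C_mul, coef_X_zero_mul, coef_X_one_mul]
  ring_nf

theorem coef_cubicQ {R : Type*} [CommRing R] (c : Fin 8 → R) (i j : ℤ) :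
    coef (cubicQ c : MvPowerSeries (Fin 2) R) i j = -coef 1 i (j - 1) + c 7 * coef 1 i (j - 3)
      + c 6 * coef 1 (i - 1) (j - 2) + c 5 * coef 1 (i - 2) (j - 1) + c 4 * coef 1 (i - 3) j := by
  open MvPowerSeries in
  have e : (cubicQ c : MvPowerSeries (Fin 2) R) = -(X 1 * 1) + C (c 7) * (X 1 * (X 1 * (X 1 * 1)))
      + C (c 6) * (X 0 * (X 1 * (X 1 * 1))) + C (c 5) * (X 0 * (X 0 * (X 1 * 1)))
      + C (c 4) * (X 0 * (X 0 * (X 0 * 1))) := by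
    rw [cubicQ]
    simp only [← MvPolynomial.coeToMvPowerSeries.ringHom_apply, map_sub, map_mul, map_pow, map_neg]
    simp only [MvPolynomial.coeToMvPowerSeries.ringHom_apply, MvPolynomial.coe_X,
      MvPolynomial.coe_C]
    ring
  simp only [e, coef_add, coef_neg, coef_C_mul, coef_X_zero_mul, coef_X_one_mul]
  ring_nf

/-- Each of the coefficients of x²y², x³y and xy³ in H is visible in both P and Q, and comparing the
two gives the three equations. Under them H is found by integration. -/
theorem isHamiltonian_iff {c : Params} : IsHamiltonian c ↔ c ∈ variety J1 := by
  rw [mem_variety_J1]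
  constructor
  · rintro ⟨H, hP, hQ⟩
    rw [Pat_eq] at hP
    rw [Qat_eq, eq_neg_iff_add_eq_zero] at hQ
    have hP' : ∀ i j, coef (cubicP c : MvPowerSeries (Fin 2) ℂ) i j
        = (j + 1 : ℤ) * coef (H : MvPowerSeries (Fin 2) ℂ) i (j + 1) := by
      intro i j
      rw [hP, ← MvPowerSeries.pderiv_coe, coef_pderiv_one]
    have hQ' : ∀ i j, coef (cubicQ c : MvPowerSeries (Fin 2) ℂ) i j
        + (i + 1 : ℤ) * coef (H : MvPowerSeries (Fin 2) ℂ) (i + 1) j = 0 := by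
      intro i j
      rw [← coef_pderiv_zero, MvPowerSeries.pderiv_coe, ← coef_add, ← MvPolynomial.coe_add, hQ,
        MvPolynomial.coe_zero]
      simp [coef]
    have p21 := hP' 2 1
    have p30 := hP' 3 0
    have p12 := hP' 1 2
    have q12 := hQ' 1 2
    have q21 := hQ' 2 1
    have q03 := hQ' 0 3
    simp [coef_cubicP, coef_cubicQ, coef_one] at p21 p30 p12 q12 q21 q03
    refine ⟨?_, ?_, ?_⟩
    · linear_combination -p21 - q12
    · linear_combination -3 * p30 - q21
    · linear_combination 3 * q03 + p12
  · rintro ⟨h1, h2, h3⟩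
    open MvPolynomial in
    refine ⟨X 0 * X 1 - C (c 0) * (X 0 ^ 3 * X 1) - C (c 1 / 2) * (X 0 ^ 2 * X 1 ^ 2)
      - C (c 2 / 3) * (X 0 * X 1 ^ 3) - C (c 3 / 4) * X 1 ^ 4 - C (c 4 / 4) * X 0 ^ 4, ?_, ?_⟩
    · have e1 : (C (c 1) : MvPolynomial (Fin 2) ℂ) = C (c 1 / 2) * 2 := by
        rw [← map_ofNat C 2, ← C_mul]; congr 1; ring
      have e2 : (C (c 2) : MvPolynomial (Fin 2) ℂ) = C (c 2 / 3) * 3 := by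
        rw [← map_ofNat C 3, ← C_mul]; congr 1; ring
      have e3 : (C (c 3) : MvPolynomial (Fin 2) ℂ) = C (c 3 / 4) * 4 := by
        rw [← map_ofNat C 4, ← C_mul]; congr 1; ring
      rw [Pat_eq, cubicP, e1, e2, e3]
      simp [Derivation.leibniz, Derivation.leibniz_pow]
      ring
    · have e1 : (C (c 6) : MvPolynomial (Fin 2) ℂ) = C (c 1 / 2) * 2 := by
        rw [← map_ofNat C 2, ← C_mul, ← h1]; congr 1; ring
      have e2 : (C (c 7) : MvPolynomial (Fin 2) ℂ) = C (c 2 / 3) := by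
        rw [← h3]; congr 1; ring
      have e3 : (C (c 4) : MvPolynomial (Fin 2) ℂ) = C (c 4 / 4) * 4 := by
        rw [← map_ofNat C 4, ← C_mul]; congr 1; ring
      have e4 : (C (c 5) : MvPolynomial (Fin 2) ℂ) = C (c 0) * 3 := by
        rw [← map_ofNat C 3, ← C_mul, ← h2]; congr 1; ring
      rw [Qat_eq, cubicQ, e1, e2, e3, e4]
      simp [Derivation.leibniz, Derivation.leibniz_pow]
      ring

variable {Ψ : MvPowerSeries (Fin 2) Coeffs} {g : ℕ → Coeffs}

theorem IsLyapunovSeries.variety_J1_subset (h : IsLyapunovSeries Ψ g) :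
    variety J1 ⊆ centerVariety g := by
  intro c hc
  obtain ⟨H, hP, hQ⟩ := isHamiltonian_iff.2 hc
  rw [Pat_eq] at hP
  rw [Qat_eq] at hQ
  refine h.mem_centerVariety_of_firstIntegral (Φ := H) ?_ fun a ha => ?_
  · rw [lieD_apply, hP, hQ, MvPowerSeries.pderiv_coe, MvPowerSeries.pderiv_coe,
      ← MvPolynomial.coe_mul, ← MvPolynomial.coe_mul, ← MvPolynomial.coe_add]
    rw [show MvPolynomial.pderiv 0 H * MvPolynomial.pderiv 1 H
      + MvPolynomial.pderiv 1 H * -MvPolynomial.pderiv 0 H = 0 by ring, MvPolynomial.coe_zero]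
  · have e : coef (cubicP c : MvPowerSeries (Fin 2) ℂ) 1 0 = 0 := by
      rw [hP, ← MvPowerSeries.pderiv_coe, ha, MvPowerSeries.pderiv_C]
      simp [coef]
    simp [coef_cubicP, coef_one] at e

/-! ### Time-reversible systems -/

/-- A system with the symmetry `(x, y, t) ↦ (δ y, δ⁻¹ x, -t)` has vanishing focus quantities. -/
theorem IsLyapunovSeries.mem_centerVariety_of_reversible (h : IsLyapunovSeries Ψ g) {c : Params}
    {δ : ℂ} (hδ : δ ≠ 0) (h0 : c 0 = δ ^ 2 * c 7) (h5 : c 5 = δ ^ 2 * c 2)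
    (h4 : c 4 = δ ^ 4 * c 3) (h1 : c 1 = c 6) : c ∈ centerVariety g := by
  obtain ⟨k1, k2⟩ := isLyapunovSeries_iff.1 h
  set F := MvPowerSeries.map (MvPolynomial.eval c) Ψ with hF
  -- F' is F(δ⁻¹y, δx). The substitution reverses the vector field and fixes every power of x y; as
  -- the derivative of F is a series in x y, those of F and F' cancel. The sum has xy-coefficient 2,
  -- so it is not constant.
  set F' : MvPowerSeries (Fin 2) ℂ := ofCoef fun i j => δ ^ (i - j) * coef F j i with hF'
  have hc : ∀ i j, coef F' i j = δ ^ (i - j) * coef F j i :=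
    coef_ofCoef fun i j hij => by rw [coef_of_neg hij.symm, mul_zero]
  have hD : ∀ i j, coef (lieD c F) i j = MvPolynomial.eval c
      (if i = j ∧ 2 ≤ i then g (i.toNat - 1) else 0) := by
    intro i j
    have e := coef_lieD_map (MvPolynomial.eval c) MvPolynomial.X Ψ i j
    simp only [MvPolynomial.eval_X] at e
    rw [e, k2]
  have hD' : ∀ i j, coef (lieD c F') i j = -(δ ^ (i - j) * coef (lieD c F) j i) := by
    intro i j
    have z1 : δ ^ (i - 2 - j) = δ ^ (i - j) / δ ^ 2 := by
      rw [show i - 2 - j = i - j - 2 by ring, zpow_sub₀ hδ]; norm_cast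
    have z2 : δ ^ (i - (j - 2)) = δ ^ (i - j) * δ ^ 2 := by
      rw [show i - (j - 2) = i - j + 2 by ring, zpow_add₀ hδ]; norm_cast
    have z3 : δ ^ (i + 1 - (j - 3)) = δ ^ (i - j) * δ ^ 4 := by
      rw [show i + 1 - (j - 3) = i - j + 4 by ring, zpow_add₀ hδ]; norm_cast
    have z4 : δ ^ (i - 3 - (j + 1)) = δ ^ (i - j) / δ ^ 4 := by
      rw [show i - 3 - (j + 1) = i - j - 4 by ring, zpow_sub₀ hδ]; norm_cast
    have z5 : δ ^ (i - 1 - (j - 1)) = δ ^ (i - j) := by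
      rw [show i - 1 - (j - 1) = i - j by ring]
    simp only [coef_lieD, cubicPart, hc, z1, z2, z3, z4, z5, h0, h5, h4, h1]
    push_cast
    field_simp
    ring
  refine h.mem_centerVariety_of_firstIntegral (Φ := F + F') (ext_coef fun i j => ?_) fun a ha => ?_
  · rw [map_add, coef_add, hD', hD, hD]
    by_cases hij : i = j
    · subst hij
      simp [coef]
    · rw [if_neg (by tauto), if_neg (fun h => hij h.1.symm)]
      simp [coef]
  · have e : coef (F + F') 1 1 = 0 := by
      rw [ha, ← mul_one (MvPowerSeries.C a), coef_C_mul, coef_one]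
      simp
    rw [coef_add, hc, hF, coef_map, k1 1 1 (by decide)] at e
    norm_num at e

theorem IsLyapunovSeries.variety_J3_subset (h : IsLyapunovSeries Ψ g) :
    variety J3 ⊆ centerVariety g := by
  rw [variety_J3_eq_range]
  -- Where z 1 and z 2 are nonzero, a square root δ of z 1 / z 2 gives the reversing symmetry.
  have hh : (MvPolynomial.X 1 * MvPolynomial.X 2 : MvPolynomial (Fin 6) ℂ) ≠ 0 :=
    mul_ne_zero (MvPolynomial.X_ne_zero _) (MvPolynomial.X_ne_zero _)
  refine range_paramPoint_subset_of_dense param3 hh fun z hz => ?_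
  rw [map_mul, MvPolynomial.eval_X, MvPolynomial.eval_X] at hz
  have h1 := left_ne_zero_of_mul hz
  have h2 := right_ne_zero_of_mul hz
  obtain ⟨δ, hδ⟩ := IsAlgClosed.exists_pow_nat_eq (z 1 / z 2) (n := 2) two_pos
  have hδ0 : δ ≠ 0 := by
    rintro rfl
    exact div_ne_zero h1 h2 (by simpa using hδ.symm)
  have hδ4 : δ ^ 4 = (z 1 / z 2) ^ 2 := by rw [← hδ]; ring
  rw [paramPoint_param3]
  refine h.mem_centerVariety_of_reversible hδ0 ?_ ?_ ?_ ?_ <;> simp [hδ, hδ4] <;> field_simp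

/-! ### Darboux integrability -/

theorem coe_orbital (c : Params) (F : MvPolynomial (Fin 2) ℂ) :
    (orbital c F : MvPowerSeries (Fin 2) ℂ) = lieD c F := by
  rw [orbital, lieD_apply, Pat_eq, Qat_eq, MvPolynomial.coe_add, MvPolynomial.coe_mul,
    MvPolynomial.coe_mul, MvPowerSeries.pderiv_coe, MvPowerSeries.pderiv_coe]

/-- A denominator with nonzero constant term is a unit among power series, so the quotient is a
formal first integral. -/
theorem IsLyapunovSeries.mem_centerVariety_of_rational (h : IsLyapunovSeries Ψ g) {c : Params}
    {F G : MvPolynomial (Fin 2) ℂ} (hFG : IsRationalFirstIntegral c F G)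
    (hG : MvPolynomial.constantCoeff G ≠ 0) : c ∈ centerVariety g := by
  obtain ⟨hG0, hne, hint⟩ := hFG
  have hinv : (G : MvPowerSeries (Fin 2) ℂ) * (G : MvPowerSeries (Fin 2) ℂ)⁻¹ = 1 :=
    MvPowerSeries.mul_inv_cancel _ (by
      rwa [← MvPowerSeries.coeff_zero_eq_constantCoeff_apply, MvPolynomial.coeff_coe])
  have hG0' : (G : MvPowerSeries (Fin 2) ℂ) ≠ 0 := left_ne_zero_of_mul (hinv ▸ one_ne_zero)
  set Φ := (F : MvPowerSeries (Fin 2) ℂ) * (G : MvPowerSeries (Fin 2) ℂ)⁻¹ with hΦ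
  have hF : (F : MvPowerSeries (Fin 2) ℂ) = Φ * G := by
    rw [hΦ, mul_assoc, mul_comm _ (G : MvPowerSeries (Fin 2) ℂ), hinv, mul_one]
  refine h.mem_centerVariety_of_firstIntegral (Φ := Φ) ?_ fun a ha => ?_
  · have e := congrArg (fun p : MvPolynomial (Fin 2) ℂ => (p : MvPowerSeries (Fin 2) ℂ)) hint
    simp only [MvPolynomial.coe_mul, coe_orbital] at e
    rw [hF, Derivation.leibniz, smul_eq_mul, smul_eq_mul] at e
    have e' : lieD c Φ * ((G : MvPowerSeries (Fin 2) ℂ) * G) = 0 := by linear_combination e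
    exact (mul_eq_zero.1 e').resolve_right (mul_ne_zero hG0' hG0')
  · refine hne a (MvPolynomial.coe_injective _ _ ?_)
    rw [MvPolynomial.coe_mul, MvPolynomial.coe_C, hF, ha]

end

end CubicCenter

namespace CubicCenter

noncomputable section

section Darboux

open MvPolynomial

/-- The invariant quartic of the systems in `V(J₂)` with `b₃₋₁ = q ≠ 0`, where `b₂₀ = q τ` and
`a₀₂ = r`. -/
def quartic (q τ r : ℂ) : MvPolynomial (Fin 2) ℂ :=
  C (4 * τ) + C (8 * q * τ ^ 2) * X 0 ^ 2 + C (-4 * (4 * q * τ ^ 3 + r)) * (X 0 * X 1)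
    + C (8 * r * τ) * X 1 ^ 2 + C (r * q) * (X 0 - C (2 * τ) * X 1) ^ 4

/-- The invariant sextic of the systems in `V(J₂)` with `b₃₋₁ = q ≠ 0`, where `b₂₀ = q τ` and
`a₀₂ = r`. -/
def sextic (q τ r : ℂ) : MvPolynomial (Fin 2) ℂ :=
  C (2 * (4 * q * τ ^ 3 + r)) + C (6 * q * τ * (4 * q * τ ^ 3 + r)) * X 0 ^ 2
    + C (-48 * r * τ ^ 2 * q) * (X 0 * X 1) + C (6 * r * (4 * q * τ ^ 3 + r)) * X 1 ^ 2
    + C (12 * r * τ ^ 2 * q ^ 2) * X 0 ^ 4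
    + C (-72 * r * q ^ 2 * τ ^ 3 - 6 * r ^ 2 * q) * (X 0 ^ 3 * X 1)
    + C (36 * τ * r ^ 2 * q + 144 * r * q ^ 2 * τ ^ 4) * (X 0 ^ 2 * X 1 ^ 2)
    + C (-72 * r ^ 2 * τ ^ 2 * q - 96 * q ^ 2 * τ ^ 5 * r) * (X 0 * X 1 ^ 3)
    + C (48 * r ^ 2 * τ ^ 3 * q) * X 1 ^ 4
    + C (r ^ 2 * q ^ 2) * (X 0 - C (2 * τ) * X 1) ^ 6

section

variable {c : Params} {q τ r : ℂ}

/-- With κ = qτx² - ry² the cofactor is 4κ here and 6κ for the sextic, so the cube of the one and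
the square of the other share the cofactor 12κ. The value of c 3 is the last equation of `J2`
divided by q. -/
theorem orbital_quartic (h0 : c 0 = -3 * (q * τ)) (h1 : c 1 = 0) (h2 : c 2 = r)
    (h3 : c 3 = 4 * r * τ) (h4 : c 4 = q) (h5 : c 5 = q * τ) (h6 : c 6 = 0) (h7 : c 7 = -3 * r) :
    orbital c (quartic q τ r)
      = C 4 * (C (q * τ) * X 0 ^ 2 - C r * X 1 ^ 2) * quartic q τ r := by
  rw [orbital, Pat_eq, Qat_eq, cubicP, cubicQ, quartic, h0, h1, h2, h3, h4, h5, h6, h7]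
  simp only [map_add, map_sub, Derivation.leibniz, Derivation.leibniz_pow, pderiv_C, pderiv_X_self,
    pderiv_X_of_ne (R := ℂ) (one_ne_zero : (1 : Fin 2) ≠ 0),
    pderiv_X_of_ne (R := ℂ) (zero_ne_one : (0 : Fin 2) ≠ 1), smul_eq_mul, nsmul_eq_mul, smul_zero,
    add_zero, zero_add, mul_zero, mul_one, Nat.add_one_sub_one]
  simp only [map_mul, map_add, map_neg, map_pow, map_ofNat, map_zero]
  push_cast
  ring

theorem orbital_sextic (h0 : c 0 = -3 * (q * τ)) (h1 : c 1 = 0) (h2 : c 2 = r)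
    (h3 : c 3 = 4 * r * τ) (h4 : c 4 = q) (h5 : c 5 = q * τ) (h6 : c 6 = 0) (h7 : c 7 = -3 * r) :
    orbital c (sextic q τ r)
      = C 6 * (C (q * τ) * X 0 ^ 2 - C r * X 1 ^ 2) * sextic q τ r := by
  rw [orbital, Pat_eq, Qat_eq, cubicP, cubicQ, sextic, h0, h1, h2, h3, h4, h5, h6, h7]
  simp only [map_add, map_sub, Derivation.leibniz, Derivation.leibniz_pow, pderiv_C, pderiv_X_self,
    pderiv_X_of_ne (R := ℂ) (one_ne_zero : (1 : Fin 2) ≠ 0),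
    pderiv_X_of_ne (R := ℂ) (zero_ne_one : (0 : Fin 2) ≠ 1), smul_eq_mul, nsmul_eq_mul, smul_zero,
    add_zero, zero_add, mul_zero, mul_one, Nat.add_one_sub_one]
  simp only [map_mul, map_add, map_neg, map_pow, map_ofNat, map_zero]
  push_cast
  ring

end

/-! ### Degree bounds, and nonconstancy from second derivatives at the origin -/

theorem totalDegree_X_sub_C_mul_X_le (a : ℂ) :
    (X 0 - C a * X 1 : MvPolynomial (Fin 2) ℂ).totalDegree ≤ 1 := by
  refine (totalDegree_sub _ _).trans (max_le (totalDegree_X _).le ?_)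
  refine (totalDegree_mul _ _).trans ?_
  rw [totalDegree_C, totalDegree_X]

theorem totalDegree_C_mul_le {n : ℕ} (a : ℂ) {p : MvPolynomial (Fin 2) ℂ}
    (h : p.totalDegree ≤ n) : (C a * p).totalDegree ≤ n := by
  refine (totalDegree_mul _ _).trans ?_
  rwa [totalDegree_C, zero_add]

theorem totalDegree_le_of_eq_monomial {n i j : ℕ} {p : MvPolynomial (Fin 2) ℂ}
    (hp : p = X 0 ^ i * X 1 ^ j) (h : i + j ≤ n) : p.totalDegree ≤ n := by
  rw [hp]
  refine (totalDegree_mul _ _).trans ?_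
  rwa [totalDegree_X_pow, totalDegree_X_pow]

theorem totalDegree_C_le (a : ℂ) (n : ℕ) : (C a : MvPolynomial (Fin 2) ℂ).totalDegree ≤ n :=
  (totalDegree_C a).le.trans (Nat.zero_le n)

theorem totalDegree_add_le {n : ℕ} {p p' : MvPolynomial (Fin 2) ℂ} (h : p.totalDegree ≤ n)
    (h' : p'.totalDegree ≤ n) : (p + p').totalDegree ≤ n :=
  (totalDegree_add _ _).trans (max_le h h')

theorem totalDegree_quartic_le (q τ r : ℂ) : (quartic q τ r).totalDegree ≤ 4 := by
  have m : ∀ {a : ℂ} {p : MvPolynomial (Fin 2) ℂ} (i j : ℕ), p = X 0 ^ i * X 1 ^ j → i + j ≤ 4 →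
      (C a * p).totalDegree ≤ 4 := fun i j hp h =>
    totalDegree_C_mul_le _ (totalDegree_le_of_eq_monomial hp h)
  have l : ∀ {a : ℂ}, (C a * (X 0 - C (2 * τ) * X 1) ^ 4 : MvPolynomial (Fin 2) ℂ).totalDegree ≤ 4 :=
    totalDegree_C_mul_le _ ((totalDegree_pow _ _).trans
      (by have := totalDegree_X_sub_C_mul_X_le (2 * τ); omega))
  rw [quartic]
  refine totalDegree_add_le ?_ l
  refine totalDegree_add_le ?_ (m 0 2 (by ring) (by norm_num))
  refine totalDegree_add_le ?_ (m 1 1 (by ring) (by norm_num))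
  refine totalDegree_add_le ?_ (m 2 0 (by ring) (by norm_num))
  exact totalDegree_C_le _ _

theorem totalDegree_sextic_le (q τ r : ℂ) : (sextic q τ r).totalDegree ≤ 6 := by
  have m : ∀ {a : ℂ} {p : MvPolynomial (Fin 2) ℂ} (i j : ℕ), p = X 0 ^ i * X 1 ^ j → i + j ≤ 6 →
      (C a * p).totalDegree ≤ 6 := fun i j hp h =>
    totalDegree_C_mul_le _ (totalDegree_le_of_eq_monomial hp h)
  have l : ∀ {a : ℂ}, (C a * (X 0 - C (2 * τ) * X 1) ^ 6 : MvPolynomial (Fin 2) ℂ).totalDegree ≤ 6 :=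
    totalDegree_C_mul_le _ ((totalDegree_pow _ _).trans
      (by have := totalDegree_X_sub_C_mul_X_le (2 * τ); omega))
  rw [sextic]
  refine totalDegree_add_le ?_ l
  refine totalDegree_add_le ?_ (m 0 4 (by ring) (by norm_num))
  refine totalDegree_add_le ?_ (m 1 3 (by ring) (by norm_num))
  refine totalDegree_add_le ?_ (m 2 2 (by ring) (by norm_num))
  refine totalDegree_add_le ?_ (m 3 1 (by ring) (by norm_num))
  refine totalDegree_add_le ?_ (m 4 0 (by ring) (by norm_num))
  refine totalDegree_add_le ?_ (m 0 2 (by ring) (by norm_num))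
  refine totalDegree_add_le ?_ (m 1 1 (by ring) (by norm_num))
  refine totalDegree_add_le ?_ (m 2 0 (by ring) (by norm_num))
  exact totalDegree_C_le _ _

/-- The value at the origin of the second derivative `∂ᵢ ∂ⱼ p`. -/
def hess (i j : Fin 2) (p : MvPolynomial (Fin 2) ℂ) : ℂ := eval 0 (pderiv i (pderiv j p))

theorem totalDegree_pos_of_hess_ne_zero {i j : Fin 2} {p : MvPolynomial (Fin 2) ℂ}
    (h : hess i j p ≠ 0) : 0 < p.totalDegree := by
  by_contra h0
  rw [totalDegree_eq_zero_iff_eq_C.1 (by omega : p.totalDegree = 0)] at h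
  simp [hess] at h

/-- At a critical point the terms with the two derivatives on different factors vanish. -/
theorem hess_pow_succ {p : MvPolynomial (Fin 2) ℂ} (h : ∀ i, eval 0 (pderiv i p) = 0)
    (n : ℕ) : hess 0 1 (p ^ (n + 1)) = (n + 1) * eval 0 p ^ n * hess 0 1 p := by
  simp only [hess, Derivation.leibniz_pow, Derivation.leibniz, smul_eq_mul, nsmul_eq_mul, map_add,
    map_mul, map_pow, map_natCast, h, Derivation.map_natCast]
  simp [mul_assoc]

theorem eval_pderiv_quartic (q τ r : ℂ) (i : Fin 2) : eval 0 (pderiv i (quartic q τ r)) = 0 := by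
  fin_cases i <;> simp [quartic, Derivation.leibniz, Derivation.leibniz_pow]

theorem eval_pderiv_sextic (q τ r : ℂ) (i : Fin 2) : eval 0 (pderiv i (sextic q τ r)) = 0 := by
  fin_cases i <;> simp [sextic, Derivation.leibniz, Derivation.leibniz_pow]

theorem eval_quartic (q τ r : ℂ) : eval 0 (quartic q τ r) = 4 * τ := by simp [quartic]

theorem eval_sextic (q τ r : ℂ) : eval 0 (sextic q τ r) = 2 * (4 * q * τ ^ 3 + r) := by
  simp [sextic]

theorem hess_xy_quartic (q τ r : ℂ) : hess 0 1 (quartic q τ r) = -4 * (4 * q * τ ^ 3 + r) := by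
  simp [hess, quartic, Derivation.leibniz, Derivation.leibniz_pow]

theorem hess_xx_quartic (q τ r : ℂ) : hess 0 0 (quartic q τ r) = 16 * q * τ ^ 2 := by
  simp [hess, quartic, Derivation.leibniz, Derivation.leibniz_pow]
  rw [map_ofNat]
  ring

theorem hess_xy_sextic (q τ r : ℂ) : hess 0 1 (sextic q τ r) = -48 * r * τ ^ 2 * q := by
  simp [hess, sextic, Derivation.leibniz, Derivation.leibniz_pow]

theorem hess_yy_sextic (q τ r : ℂ) :
    hess 1 1 (sextic q τ r) = 12 * r * (4 * q * τ ^ 3 + r) := by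
  simp [hess, sextic, Derivation.leibniz, Derivation.leibniz_pow]
  rw [map_ofNat]
  ring

theorem hess_xx_sextic (q τ r : ℂ) :
    hess 0 0 (sextic q τ r) = 12 * q * τ * (4 * q * τ ^ 3 + r) := by
  simp [hess, sextic, Derivation.leibniz, Derivation.leibniz_pow]
  rw [map_ofNat]
  ring

theorem totalDegree_quartic_pos {q τ r : ℂ} (hq : q ≠ 0) (h : r ≠ 4 * q * τ ^ 3) :
    0 < (quartic q τ r).totalDegree := by
  by_cases hτ : τ = 0
  · refine totalDegree_pos_of_hess_ne_zero (i := 0) (j := 1) ?_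
    rw [hess_xy_quartic]
    simpa [hτ] using h
  · refine totalDegree_pos_of_hess_ne_zero (i := 0) (j := 0) ?_
    rw [hess_xx_quartic]
    simp [hq, hτ]

theorem totalDegree_sextic_pos {q τ r : ℂ} (hq : q ≠ 0) (h : r ≠ 4 * q * τ ^ 3) :
    0 < (sextic q τ r).totalDegree := by
  by_cases hw : 4 * q * τ ^ 3 + r = 0
  · refine totalDegree_pos_of_hess_ne_zero (i := 0) (j := 1) ?_
    rw [hess_xy_sextic]
    have hτ : τ ≠ 0 := by
      rintro rfl
      exact h (by linear_combination hw)
    have hr : r ≠ 0 := by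
      rintro rfl
      simp [hq, hτ] at hw
    simp [hq, hτ, hr]
  · by_cases hr : r = 0
    · have hτ : τ ≠ 0 := by
        rintro rfl
        simp [hr] at hw
      refine totalDegree_pos_of_hess_ne_zero (i := 0) (j := 0) ?_
      rw [hess_xx_sextic]
      simp [hq, hτ, hw]
    · refine totalDegree_pos_of_hess_ne_zero (i := 1) (j := 1) ?_
      rw [hess_yy_sextic]
      simp [hr, hw]

theorem ne_zero_of_totalDegree_pos {p : MvPolynomial (Fin 2) ℂ} (h : 0 < p.totalDegree) :
    p ≠ 0 := by
  rintro rfl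
  simp at h

/-- With w = 4qτ³ + r, the constant terms give 16τ³ = k w², and the xy-coefficients give k r q = 1
when τ and w are nonzero. Together, w² = 16qrτ³, that is (4qτ³ - r)² = 0, which is excluded. The
cases τ = 0 and w = 0 fail by constant terms, the former because it forces k = 0. -/
theorem quartic_pow_ne_C_mul_sextic_pow {q τ r : ℂ} (hq : q ≠ 0) (h : r ≠ 4 * q * τ ^ 3) (k : ℂ) :
    quartic q τ r ^ 3 ≠ C k * sextic q τ r ^ 2 := by
  intro e
  have e0 := congrArg (eval 0) e
  have e1 := congrArg (hess 0 1) e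
  have hC : hess 0 1 (C k * sextic q τ r ^ 2) = k * hess 0 1 (sextic q τ r ^ 2) := by
    simp [hess, Derivation.leibniz]
  rw [hC, hess_pow_succ (eval_pderiv_quartic q τ r),
    hess_pow_succ (eval_pderiv_sextic q τ r), eval_quartic, eval_sextic, hess_xy_quartic,
    hess_xy_sextic] at e1
  simp only [map_mul, map_pow, eval_C, eval_quartic, eval_sextic] at e0
  push_cast at e1
  by_cases hτ : τ = 0
  · have hk : k = 0 := by
      have hr : r ≠ 0 := by simpa [hτ] using h
      simpa [hτ, hr] using e0
    rw [hk, map_zero, zero_mul] at e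
    exact ne_zero_of_totalDegree_pos (totalDegree_quartic_pos hq h)
      (pow_eq_zero_iff three_ne_zero |>.1 e)
  by_cases hw : 4 * q * τ ^ 3 + r = 0
  · rw [hw] at e0
    simp [hτ] at e0
  · have e2 : k * r * q = 1 := by
      refine mul_left_cancel₀ (mul_ne_zero hw (pow_ne_zero 2 hτ)) ?_
      linear_combination e1 / 192
    refine h (sub_eq_zero.1 (pow_eq_zero_iff two_ne_zero |>.1 ?_))
    linear_combination -(4 * q * τ ^ 3 + r) ^ 2 * e2 - r * q / 4 * e0

/-- If c 4 ≠ 0, a point of V(H) has c 5 = c 2 = 0 and so violates the inequality; hence only c 4 = 0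
is removed by V(H). -/
theorem mem_darbouxSet {c : Params} :
    c ∈ darbouxSet ↔ c ∈ variety J2 ∧ c 4 ≠ 0 ∧ c 2 * c 4 ^ 2 ≠ 4 * c 5 ^ 3 := by
  have hH : c ∈ variety idealH ↔ c 5 * c 4 ^ 2 = 0 ∧
      c 4 ^ 2 * (c 2 * c 4 ^ 2 + 4 * c 5 ^ 3) = 0 := by
    simp [idealH, mem_variety_span, b20, b3m1, a02]
  have e : MvPolynomial.eval c (a02 * b3m1 ^ 2) ≠ MvPolynomial.eval c (4 * b20 ^ 3) ↔
      c 2 * c 4 ^ 2 ≠ 4 * c 5 ^ 3 := by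
    simp [b20, b3m1, a02]
  change (_ ∧ _ ∧ _) ↔ _
  rw [hH, e]
  refine and_congr_right fun _ => and_congr_left fun h => ?_
  constructor
  · intro h' h4
    exact h' (by simp [h4])
  · rintro h4 ⟨h5, h6⟩
    have h5 : c 5 = 0 := by simpa [h4] using h5
    have h2 : c 2 = 0 := by simpa [h4, h5] using h6
    exact h (by simp [h5, h2])

/-- On the Darboux set the quartic and the sextic are invariant curves that yield a first
integral. -/
theorem exists_darboux_of_mem {c : Params} (hc : c ∈ darbouxSet) :
    ∃ τ : ℂ, c 5 = c 4 * τ ∧ IsInvariantCurve c (quartic (c 4) τ (c 2)) ∧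
      IsInvariantCurve c (sextic (c 4) τ (c 2)) ∧
      IsRationalFirstIntegral c (quartic (c 4) τ (c 2) ^ 3) (sextic (c 4) τ (c 2) ^ 2) := by
  obtain ⟨hJ, hq, hne⟩ := mem_darbouxSet.1 hc
  obtain ⟨h1, h6, h0, h7, h3⟩ := mem_variety_J2.1 hJ
  obtain ⟨τ, hτ⟩ : ∃ τ, c 5 = c 4 * τ := ⟨c 5 / c 4, by field_simp⟩
  have h0' : c 0 = -3 * (c 4 * τ) := by linear_combination h0 - 3 * hτ
  have h7' : c 7 = -3 * c 2 := by linear_combination h7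
  have h3' : c 3 = 4 * c 2 * τ := mul_left_cancel₀ hq (by rw [hτ] at h3; linear_combination h3)
  have hne' : c 2 ≠ 4 * c 4 * τ ^ 3 := fun h => hne (by rw [h, hτ]; ring)
  have o1 := orbital_quartic h0' h1 rfl h3' rfl hτ h6 h7'
  have o2 := orbital_sextic h0' h1 rfl h3' rfl hτ h6 h7'
  refine ⟨τ, hτ, ⟨totalDegree_quartic_pos hq hne', _, o1⟩, ⟨totalDegree_sextic_pos hq hne', _, o2⟩,
    pow_ne_zero 2 (ne_zero_of_totalDegree_pos (totalDegree_sextic_pos hq hne')),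
    quartic_pow_ne_C_mul_sextic_pow hq hne', ?_⟩
  have ho : ∀ (p : MvPolynomial (Fin 2) ℂ) (n : ℕ),
      orbital c (p ^ (n + 1)) = (n + 1 : ℕ) * p ^ n * orbital c p := by
    intro p n
    simp only [orbital, Derivation.leibniz_pow, smul_eq_mul, nsmul_eq_mul, add_tsub_cancel_right]
    ring
  rw [ho _ 2, ho _ 1, o1, o2, map_ofNat C 4, map_ofNat C 6]
  push_cast
  ring

/-- The points of `V(J₂)` at which the Darboux first integral is defined at the origin form a
dense subset. -/
theorem exists_dense_darboux : ∃ h : MvPolynomial (Fin 4) ℂ, h ≠ 0 ∧ ∀ z, eval z h ≠ 0 →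
    paramPoint param2 z ∈ darbouxSet ∧
      paramPoint param2 z 2 * paramPoint param2 z 4 ^ 2 + 4 * paramPoint param2 z 5 ^ 3 ≠ 0 := by
  -- The last factor is c 4² times half the constant term of the sextic, so its nonvanishing makes
  -- the denominator invertible at the origin.
  refine ⟨aeval param2 (X 4 * (X 2 * X 4 ^ 2 - 4 * X 5 ^ 3) * (X 2 * X 4 ^ 2 + 4 * X 5 ^ 3) :
    Coeffs), fun h => ?_, fun z hz => ?_⟩
  -- The all-ones point would not do, as the second factor vanishes there.
  · have := congrArg (eval ![2, 1, 1, 1]) h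
    rw [← eval_paramPoint, paramPoint_param2] at this
    simp at this
    norm_num at this
  · rw [← eval_paramPoint] at hz
    simp only [map_mul, map_sub, map_add, map_pow, map_ofNat, eval_X, mul_ne_zero_iff, sub_ne_zero]
      at hz
    refine ⟨mem_darbouxSet.2 ⟨variety_J2_eq_range ▸ ⟨z, rfl⟩, hz.1.1, hz.1.2⟩, hz.2⟩

theorem zariskiClosure_darbouxSet : zariskiClosure darbouxSet = variety J2 := by
  refine Set.Subset.antisymm (fun c hc p hp => hc p ?_) ?_
  · exact fun z hz => hz.1 p hp
  · obtain ⟨h, hh, H⟩ := exists_dense_darboux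
    rw [variety_J2_eq_range]
    refine range_paramPoint_subset_of_dense param2 hh fun z hz p hp => ?_
    exact hp _ (H z hz).1

theorem IsLyapunovSeries.variety_J2_subset {Ψ : MvPowerSeries (Fin 2) Coeffs} {g : ℕ → Coeffs}
    (h : IsLyapunovSeries Ψ g) : variety J2 ⊆ centerVariety g := by
  obtain ⟨f, hf, H⟩ := exists_dense_darboux
  rw [variety_J2_eq_range]
  refine range_paramPoint_subset_of_dense param2 hf fun z hz => ?_
  obtain ⟨hmem, hw⟩ := H z hz
  obtain ⟨τ, hτ, -, -, hint⟩ := exists_darboux_of_mem hmem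
  refine h.mem_centerVariety_of_rational hint ?_
  set c := paramPoint param2 z
  rw [← eval_zero, map_pow, eval_sextic]
  refine pow_ne_zero 2 (mul_ne_zero two_ne_zero fun hz => hw ?_)
  rw [hτ]
  linear_combination c 4 ^ 2 * hz

end Darboux

end

end CubicCenter

/-! ### Assembly of the theorem -/

theorem mainTheorem7 :
    -- focus quantities exist
    (∃ (Ψ : MvPowerSeries (Fin 2) CubicCenter.Coeffs) (g : ℕ → CubicCenter.Coeffs),
      CubicCenter.IsLyapunovSeries Ψ g) ∧
    -- the decomposition, for every choice of the Lyapunov series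
    (∀ (Ψ : MvPowerSeries (Fin 2) CubicCenter.Coeffs) (g : ℕ → CubicCenter.Coeffs),
      CubicCenter.IsLyapunovSeries Ψ g →
        CubicCenter.centerVariety g =
          CubicCenter.variety (CubicCenter.bautinIdealUpTo g 5) ∧
        CubicCenter.centerVariety g =
          CubicCenter.variety CubicCenter.J1 ∪ CubicCenter.variety CubicCenter.J2 ∪
            CubicCenter.variety CubicCenter.J3 ∧
        {W | CubicCenter.IsComponent W (CubicCenter.centerVariety g)} =
          {CubicCenter.variety CubicCenter.J1, CubicCenter.variety CubicCenter.J2,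
            CubicCenter.variety CubicCenter.J3}) ∧
    -- the three components are distinct
    CubicCenter.variety CubicCenter.J1 ≠ CubicCenter.variety CubicCenter.J2 ∧
    CubicCenter.variety CubicCenter.J1 ≠ CubicCenter.variety CubicCenter.J3 ∧
    CubicCenter.variety CubicCenter.J2 ≠ CubicCenter.variety CubicCenter.J3 ∧
    -- the first component consists of the Hamiltonian systems
    CubicCenter.variety CubicCenter.J1 = {c | CubicCenter.IsHamiltonian c} ∧
    -- on a dense subset of the second one there is a Darboux first integral
    (CubicCenter.zariskiClosure CubicCenter.darbouxSet = CubicCenter.variety CubicCenter.J2 ∧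
      ∀ c ∈ CubicCenter.darbouxSet, ∃ l₁ l₂ : MvPolynomial (Fin 2) ℂ,
        l₁.totalDegree ≤ 4 ∧ l₂.totalDegree ≤ 6 ∧
        CubicCenter.IsInvariantCurve c l₁ ∧ CubicCenter.IsInvariantCurve c l₂ ∧
        CubicCenter.IsRationalFirstIntegral c (l₁ ^ 3) (l₂ ^ 2)) ∧
    -- the third one is the symmetry component
    CubicCenter.variety CubicCenter.J3 = CubicCenter.symmetryComponent := by
  open CubicCenter in
  refine ⟨exists_isLyapunovSeries, fun Ψ g h => ?_, ?_, ?_, ?_, ?_,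
    ⟨zariskiClosure_darbouxSet, fun c hc => ?_⟩, variety_J3_eq_symmetryComponent⟩
  · have h1 : centerVariety g ⊆ variety (bautinIdealUpTo g 5) := fun c hc =>
      mem_variety_bautinIdealUpTo.2 fun k hk _ => mem_centerVariety.1 hc k hk
    have h2 := variety_bautinIdealUpTo_five_subset h
    have h3 : variety J1 ∪ variety J2 ∪ variety J3 ⊆ centerVariety g :=
      Set.union_subset (Set.union_subset h.variety_J1_subset h.variety_J2_subset)
        h.variety_J3_subset
    have h4 : centerVariety g = variety J1 ∪ variety J2 ∪ variety J3 :=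
      (h1.trans h2).antisymm h3
    refine ⟨h1.antisymm (h2.trans h3), h4, ?_⟩
    rw [h4]
    exact setOf_isComponent_union isIrreducibleVariety_J1 isIrreducibleVariety_J2
      isIrreducibleVariety_J3 not_J1_subset_J2 not_J1_subset_J3 not_J2_subset_J1 not_J2_subset_J3
      not_J3_subset_J1 not_J3_subset_J2
  · exact fun h => not_J1_subset_J2 h.subset
  · exact fun h => not_J1_subset_J3 h.subset
  · exact fun h => not_J2_subset_J3 h.subset
  · ext c
    exact isHamiltonian_iff.symm
  · obtain ⟨τ, -, h1, h2, h3⟩ := exists_darboux_of_mem hc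
    exact ⟨_, _, totalDegree_quartic_le _ _ _, totalDegree_sextic_le _ _ _, h1, h2, h3⟩
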